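/- Let $m,n\ge 2$. Let $L^\infty(\mathbb M_{m,n})$ be the space of essentially bounded $m\times n$ matrix functions on the unit circle $\mathbb T$, with norm $\operatorname{ess\,sup}_{\zeta}\|\Phi(\zeta)\|$ (operator norm $\mathbb C^n\to\mathbb C^m$), and $H^\infty(\mathbb M_{m,n})$ the subspace of bounded analytic functions (vanishing Fourier coefficients of negative order). Let $H^2(\mathbb C^n)\subset L^2(\mathbb C^n)$ be the Hardy space, $H^2_-(\mathbb C^n)=L^2(\mathbb C^n)\ominus H^2(\mathbb C^n)$, and let $\mathbb P_\pm$ be the orthogonal projections onto $H^2$ and $H^2_-$. For $\Phi\in L^\infty(\mathbb M_{m,n})$ let $H_\Phi f=\mathbb P_-(\Phi f)$ and $T_\Phi f=\mathbb P_+(\Phi f)$, $f\in H^2(\mathbb C^n)$, be the Hankel and Toeplitz operators, and put $$\mathcal M_\Phi=\{f\in H^2(\mathbb C^n):\ \|H_\Phi f\|_2=\|H_\Phi\|\,\|f\|_2\}.$$ The essential norm $\|T\|_{\rm e}$ of an operator is its distance to the compact operators, and $\operatorname{ind}T=\dim\ker T-\dim\operatorname{coker}T$ for a Fredholm operator $T$.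 The function $\Phi$ is called badly approximable if $\|\Phi\|_{L^\infty}=\operatorname{dist}_{L^\infty}(\Phi,H^\infty)$. A function $\Theta\in H^\infty(\mathbb M_{m,n})$ is inner if $\Theta^*\Theta=I_n$ a.e., outer if $\Theta H^2(\mathbb C^n)$ is dense in $H^2(\mathbb C^m)$, and co-outer if $\Theta^t$ is outer. An $n\times n$ matrix function is thematic if it is unitary-valued and of the form $(\,v\ \ \overline\Theta\,)$, where $v$ ($n\times1$) and $\Theta$ ($n\times(n-1)$) are inner and co-outer. Let $G\in L^\infty(\mathbb M_{m,n})$ be badly approximable with $\|H_G\|_{\rm e}<1$ and $\|H_G\|=1$, and suppose that $$G=W^*\begin{pmatrix}u&0\\0&\Psi\end{pmatrix}V^*,$$ where $V=(\,v\ \ \overline\Theta\,)$ and $W^t=(\,w\ \ \overline\Xi\,)$ are thematic, $u$ is a unimodular function and $\Psi\in L^\infty(\mathbb M_{m-1,n-1})$. 1. If $f\in\mathcal M_G$ satisfies $\Theta^tf=0$, then $f=\xi v$ for some $\xi\in\ker T_u$. 2. If $\Psi$ is badly approximable with $\|\Psi\|_{L^\infty}=1$ and $T_u$ is Fredholm with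 $\operatorname{ind}T_u\le0$, then $\dim\mathcal M_G\le\dim\mathcal M_\Psi$. If moreover $\operatorname{ind}T_u=0$, then $\dim\mathcal M_G=\dim\mathcal M_\Psi$. -/

import Mathlib

open MeasureTheory AddCircle
open scoped ENNReal Matrix Matrix.Norms.L2Operator

noncomputable section

/-- The unit circle `𝕋`, parametrized by `t ↦ ζ = exp (2πit)`, `t ∈ ℝ/ℤ`; it carries the normalized
Lebesgue measure `haarAddCircle`, and `z ^ k` is `fourier k`. -/
abbrev Circ : Type := UnitAddCircle

/-- `L²(ℂⁿ)`. -/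
abbrev L2 (n : ℕ) : Type := Lp (EuclideanSpace ℂ (Fin n)) 2 (haarAddCircle : Measure Circ)

/-- `L^∞(𝕄_{m,n})`. Matrices carry the operator norm induced by the Euclidean norms of `ℂⁿ` and
`ℂᵐ`, so the norm of `Φ` is the essential supremum of `‖Φ(ζ)‖`. Scalar functions in `L^∞` are
identified with `1 × 1` matrix functions, and columns with `n × 1` matrix functions. -/
abbrev Linfty (m n : ℕ) : Type := Lp (Matrix (Fin m) (Fin n) ℂ) ∞ (haarAddCircle : Measure Circ)

/-- The `k`-th Fourier coefficient as a linear map on `L^p(E)`. -/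
def coeffLM (E : Type) [NormedAddCommGroup E] [NormedSpace ℂ E] [CompleteSpace E]
    (p : ℝ≥0∞) [Fact (1 ≤ p)] (k : ℤ) : Lp E p (haarAddCircle : Measure Circ) →ₗ[ℂ] E where
  toFun f := fourierCoeff (f : Circ → E) k
  map_add' f g := by
    have hi : ∀ h : Lp E p (haarAddCircle : Measure Circ),
        Integrable (fun t => fourier (-k) t • h t) haarAddCircle := fun h =>
      ((Lp.memLp h).integrable Fact.out).bdd_smul 1
        (map_continuous (fourier (-k))).aestronglyMeasurable
        (Filter.Eventually.of_forall fun t => by rw [fourier_apply]; exact (Circle.norm_coe _).le)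
    unfold fourierCoeff
    rw [← integral_add (hi f) (hi g)]
    refine integral_congr_ae ?_
    filter_upwards [Lp.coeFn_add f g] with t ht
    rw [ht, Pi.add_apply, smul_add]
  map_smul' c f := by
    unfold fourierCoeff
    rw [RingHom.id_apply, ← integral_smul]
    refine integral_congr_ae ?_
    filter_upwards [Lp.coeFn_smul c f] with t ht
    rw [ht, Pi.smul_apply, smul_comm]

/-- The functions of `L^p(E)` whose Fourier coefficients of negative order vanish. -/
def hardy (E : Type) [NormedAddCommGroup E] [NormedSpace ℂ E] [CompleteSpace E]
    (p : ℝ≥0∞) [Fact (1 ≤ p)] : Submodule ℂ (Lp E p (haarAddCircle : Measure Circ)) :=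
  ⨅ k : ℤ, ⨅ _ : k < 0, LinearMap.ker (coeffLM E p k)

theorem mem_hardy {E : Type} [NormedAddCommGroup E] [NormedSpace ℂ E] [CompleteSpace E]
    {p : ℝ≥0∞} [Fact (1 ≤ p)] {f : Lp E p (haarAddCircle : Measure Circ)} :
    f ∈ hardy E p ↔ ∀ k : ℤ, k < 0 → fourierCoeff (f : Circ → E) k = 0 := by
  simp [hardy, Submodule.mem_iInf, coeffLM]

/-- The Hardy space `H²(ℂⁿ)`. -/
abbrev H2 (n : ℕ) : Submodule ℂ (L2 n) := hardy (EuclideanSpace ℂ (Fin n)) 2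

/-- The space `H^∞(𝕄_{m,n})` of bounded analytic matrix functions. -/
abbrev Hinfty (m n : ℕ) : Submodule ℂ (Linfty m n) := hardy (Matrix (Fin m) (Fin n) ℂ) ∞

/-- The space `H²₋(ℂⁿ) = L²(ℂⁿ) ⊖ H²(ℂⁿ)`. -/
abbrev H2minus (n : ℕ) : Submodule ℂ (L2 n) := (H2 n)ᗮ

theorem coeffLM_bound (n : ℕ) (k : ℤ) (f : L2 n) :
    ‖coeffLM (EuclideanSpace ℂ (Fin n)) 2 k f‖ ≤ 1 * ‖f‖ := by
  have h1 : ‖coeffLM (EuclideanSpace ℂ (Fin n)) 2 k f‖ ≤ ∫ t, ‖f t‖ ∂haarAddCircle := by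
    refine (norm_integral_le_integral_norm _).trans (le_of_eq ?_)
    refine integral_congr_ae (Filter.Eventually.of_forall fun t => ?_)
    simp only [norm_smul, fourier_apply]
    rw [Circle.norm_coe, one_mul]
  refine h1.trans ?_
  rw [one_mul, integral_norm_eq_lintegral_enorm (Lp.aestronglyMeasurable f), Lp.norm_def,
    ← eLpNorm_one_eq_lintegral_enorm]
  exact ENNReal.toReal_mono (Lp.eLpNorm_ne_top f)
    (eLpNorm_le_eLpNorm_of_exponent_le (by norm_num) (Lp.aestronglyMeasurable f))

theorem isClosed_H2 (n : ℕ) : IsClosed (H2 n : Set (L2 n)) := by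
  have : (H2 n : Set (L2 n)) = ⋂ k : ℤ, ⋂ _ : k < 0,
      {f | (coeffLM (EuclideanSpace ℂ (Fin n)) 2 k).mkContinuous 1 (coeffLM_bound n k) f = 0} := by
    ext f
    simp [hardy]
  rw [this]
  exact isClosed_iInter fun k => isClosed_iInter fun _ =>
    isClosed_eq (ContinuousLinearMap.continuous _) continuous_const

instance instCompleteSpaceH2 (n : ℕ) : CompleteSpace (H2 n) :=
  (isClosed_H2 n).completeSpace_coe

/-- The continuous bilinear map `(A, x) ↦ A x` on `𝕄_{m,n} × ℂⁿ`. -/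
def mulVecBilin (m n : ℕ) : Matrix (Fin m) (Fin n) ℂ →L[ℂ]
    EuclideanSpace ℂ (Fin n) →L[ℂ] EuclideanSpace ℂ (Fin m) :=
  LinearMap.toContinuousLinearMap
    ((Matrix.toEuclideanLin (𝕜 := ℂ) (m := Fin m) (n := Fin n)).trans
      LinearMap.toContinuousLinearMap).toLinearMap

/-- Multiplication by `Φ ∈ L^∞(𝕄_{m,n})`, as a bounded operator `L²(ℂⁿ) → L²(ℂᵐ)`. -/
def mulOp {m n : ℕ} (Φ : Linfty m n) : L2 n →L[ℂ] L2 m :=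
  (mulVecBilin m n).holderL haarAddCircle ∞ 2 2 Φ

theorem mulOp_ae {m n : ℕ} (Φ : Linfty m n) (f : L2 n) :
    ∀ᵐ t ∂(haarAddCircle : Measure Circ), (mulOp Φ f t).ofLp = Φ t *ᵥ (f t).ofLp := by
  filter_upwards [(mulVecBilin m n).coeFn_holder (r := 2) Φ f] with t ht
  exact congrArg WithLp.ofLp ht

/-- The Hankel operator `H_Φ f = ℙ₋(Φ f)`, from `H²(ℂⁿ)` to `H²₋(ℂᵐ)`. -/
def hankel {m n : ℕ} (Φ : Linfty m n) : H2 n →L[ℂ] H2minus m :=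
  (H2minus m).orthogonalProjectionOnto ∘L mulOp Φ ∘L (H2 n).subtypeL

/-- The Toeplitz operator `T_Φ f = ℙ₊(Φ f)`, from `H²(ℂⁿ)` to `H²(ℂᵐ)`. -/
def toeplitz {m n : ℕ} (Φ : Linfty m n) : H2 n →L[ℂ] H2 m :=
  (H2 m).orthogonalProjectionOnto ∘L mulOp Φ ∘L (H2 n).subtypeL

/-- The essential norm of `T`: its distance to the compact operators. -/
def essNorm {E F : Type} [NormedAddCommGroup E] [NormedSpace ℂ E] [NormedAddCommGroup F]
    [NormedSpace ℂ F] (T : E →L[ℂ] F) : ℝ :=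
  sInf {r : ℝ | ∃ K : E →L[ℂ] F, IsCompactOperator K ∧ r = ‖T - K‖}

/-- The index `dim ker T - dim coker T` of a Fredholm operator `T`. -/
def fredholmIndex {E F : Type} [NormedAddCommGroup E] [NormedSpace ℂ E] [NormedAddCommGroup F]
    [NormedSpace ℂ F] (T : E →L[ℂ] F) : ℤ :=
  (Module.finrank ℂ T.ker : ℤ) - (Module.finrank ℂ (F ⧸ T.range) : ℤ)

/-- The subspace `{f : ‖T f‖ = ‖T‖ ‖f‖}`, which consists of `0` and the maximizing vectors
of `T`. -/
def maximizing {E F : Type} [NormedAddCommGroup E] [InnerProductSpace ℂ E]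
    [NormedAddCommGroup F] [InnerProductSpace ℂ F] (T : E →L[ℂ] F) : Submodule ℂ E where
  carrier := {f | ‖T f‖ = ‖T‖ * ‖f‖}
  zero_mem' := by simp
  add_mem' := by
    intro f g hf hg
    simp only [Set.mem_ofPred_eq] at hf hg ⊢
    have h1 := parallelogram_law_with_norm ℂ (T f) (T g)
    have h2 := parallelogram_law_with_norm ℂ f g
    rw [← map_add, ← map_sub, hf, hg] at h1
    have h3 := T.le_opNorm (f + g)
    have h4 := T.le_opNorm (f - g)
    have h5 := mul_self_le_mul_self (norm_nonneg _) h4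
    refine le_antisymm h3 (abs_le_of_sq_le_sq' ?_ (norm_nonneg _)).2
    have h6 := congrArg (fun x => ‖T‖ ^ 2 * x) h2
    ring_nf at h1 h5 h6 ⊢
    linarith
  smul_mem' := by
    intro c f hf
    simp only [Set.mem_ofPred_eq] at hf ⊢
    rw [map_smul, norm_smul, norm_smul, hf]
    ring

/-- The space `𝓜_Φ = {f ∈ H²(ℂⁿ) : ‖H_Φ f‖ = ‖H_Φ‖ ‖f‖}`. -/
def maxVectors {m n : ℕ} (Φ : Linfty m n) : Submodule ℂ (H2 n) := maximizing (hankel Φ)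

/-- `F ∈ H^∞` is a best approximation of `Φ` if `‖Φ - F‖ = dist (Φ, H^∞)`. -/
def IsBestApprox {m n : ℕ} (Φ F : Linfty m n) : Prop :=
  F ∈ Hinfty m n ∧ ‖Φ - F‖ = Metric.infDist Φ (Hinfty m n : Set (Linfty m n))

/-- `Φ` is badly approximable if the zero function is a best approximation of `Φ`. -/
def IsBadlyApprox {m n : ℕ} (Φ : Linfty m n) : Prop := IsBestApprox Φ 0

/-- The scalar function `u` is unimodular. -/
def IsUnimodular (u : Linfty 1 1) : Prop :=
  ∀ᵐ t ∂(haarAddCircle : Measure Circ), ‖u t 0 0‖ = 1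

/-- The transposed matrix function `Φᵗ`. -/
def transp {m n : ℕ} (Φ : Linfty m n) : Linfty n m :=
  (LinearMap.toContinuousLinearMap
    (Matrix.transposeLinearEquiv (Fin m) (Fin n) ℂ ℂ).toLinearMap).compLp Φ

theorem transp_ae {m n : ℕ} (Φ : Linfty m n) :
    ∀ᵐ t ∂(haarAddCircle : Measure Circ), transp Φ t = (Φ t)ᵀ := by
  filter_upwards [ContinuousLinearMap.coeFn_compLp (LinearMap.toContinuousLinearMap
    (Matrix.transposeLinearEquiv (Fin m) (Fin n) ℂ ℂ).toLinearMap) Φ] with t ht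
  exact ht

/-- `Θ ∈ H^∞(𝕄_{m,n})` is inner if `Θ* Θ = I_n` a.e. -/
def IsInner {m n : ℕ} (Θ : Linfty m n) : Prop :=
  Θ ∈ Hinfty m n ∧ ∀ᵐ t ∂(haarAddCircle : Measure Circ), (Θ t)ᴴ * Θ t = 1

/-- `F ∈ H^∞(𝕄_{m,n})` is outer if `F H²(ℂⁿ)` is dense in `H²(ℂᵐ)`. -/
def IsOuter {m n : ℕ} (F : Linfty m n) : Prop :=
  F ∈ Hinfty m n ∧ closure (mulOp F '' (H2 n : Set (L2 n))) = (H2 m : Set (L2 m))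

/-- `F ∈ H^∞` is co-outer if `Fᵗ` is outer. -/
def IsCoOuter {m n : ℕ} (F : Linfty m n) : Prop := IsOuter (transp F)

/-- The function with values `(v(ζ)  conj Θ(ζ))`: the first column is `v`, and the other columns
are those of the entrywise complex conjugate of `Θ`. -/
def thematicMatrix {n k : ℕ} (v : Linfty n 1) (Θ : Linfty n k) (t : Circ) :
    Matrix (Fin n) (Fin 1 ⊕ Fin k) ℂ :=
  Matrix.fromCols (v t) ((Θ t).map star)

/-- `V = (v  conj Θ)` is thematic: it is unitary-valued, of size `n × n` with `n ≥ 2`, and the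
functions `v`, of size `n × 1`, and `Θ`, of size `n × (n - 1)`, are inner and co-outer. -/
structure IsThematic {n : ℕ} (v : Linfty n 1) (Θ : Linfty n (n - 1)) : Prop where
  two_le : 2 ≤ n
  inner_v : IsInner v
  coOuter_v : IsCoOuter v
  inner_Θ : IsInner Θ
  coOuter_Θ : IsCoOuter Θ
  unitary : ∀ᵐ t ∂(haarAddCircle : Measure Circ),
    (thematicMatrix v Θ t)ᴴ * thematicMatrix v Θ t = 1 ∧
      thematicMatrix v Θ t * (thematicMatrix v Θ t)ᴴ = 1

/-- `G = W* diag(u, Ψ) V*` a.e., where `V = (v  conj Θ)` and `Wᵗ = (w  conj Ξ)`. -/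
def Factors {m n : ℕ} (G : Linfty m n) (w : Linfty m 1) (Ξ : Linfty m (m - 1)) (u : Linfty 1 1)
    (Ψ : Linfty (m - 1) (n - 1)) (v : Linfty n 1) (Θ : Linfty n (n - 1)) : Prop :=
  ∀ᵐ t ∂(haarAddCircle : Measure Circ),
    G t = ((thematicMatrix w Ξ t)ᵀ)ᴴ * Matrix.fromBlocks (u t) 0 0 (Ψ t) * (thematicMatrix v Θ t)ᴴ

end

/-!
As `V` is unitary-valued, `‖f‖² - ‖G f‖² = ‖Θᵗf‖² - ‖Ψ Θᵗf‖²`, and maximizing vectors of `H_G` are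
the `f ∈ H²` with `G f ∈ H²₋` for which this quantity vanishes. Hence `f ↦ Θᵗf` maps `𝓜_G` into
`𝓜_Ψ`, and since `v` and `w` are inner and co-outer, its kernel on `𝓜_G` is `v ker T_u`. By Coburn's
lemma this kernel is trivial if `ind T_u ≤ 0`.

If `T_u` is onto, then each `g ∈ 𝓜_Ψ` is attained. Since `Θ` and `Ξ` are co-outer, `g` is a limit of
functions `Θᵗf_j` with `f_j ∈ H²`, and `Ψ g ∈ H²₋` is a limit of functions `Ξ* y_j` with
`y_j ∈ H²₋`. Solving a Toeplitz equation with symbol `u` corrects `f_j` by a multiple of `v`, which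
does not change `Θᵗf_j`, so that `T_G f_j → 0`. Then `‖f_j‖² - ‖H_G f_j‖² → 0`, and the gap
between the essential norm of `H_G` and its norm forces `f_j` to approach the finite-dimensional
space `𝓜_G`, whose image under `Θᵗ` is closed.
-/

/-! ### Fourier coefficients -/

section FourierCoeff

variable {E F : Type*} [NormedAddCommGroup E] [NormedSpace ℂ E] [NormedAddCommGroup F]
  [NormedSpace ℂ F]

theorem fourierCoeff_clm_comp [CompleteSpace E] [CompleteSpace F] (L : E →L[ℂ] F) {f : Circ → E}
    (hf : Integrable f haarAddCircle) (k : ℤ) :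
    fourierCoeff (fun t => L (f t)) k = L (fourierCoeff f k) := by
  simp only [fourierCoeff, ← map_smul]
  exact L.integral_comp_comm (hf.fourier_smul (-k))

theorem fourierCoeff_fourier_smul (f : Circ → E) (p k : ℤ) :
    fourierCoeff (fun t => (fourier p t : ℂ) • f t) k = fourierCoeff f (k - p) := by
  simp only [fourierCoeff, smul_smul, ← fourier_add]
  rw [neg_sub, neg_add_eq_sub]

theorem fourierCoeff_const [CompleteSpace E] (x : E) (k : ℤ) :
    fourierCoeff (Function.const Circ x) k = if k = 0 then x else 0 := by
  have h_one : fourierCoeff (Function.const Circ (1 : ℂ)) k = if k = 0 then 1 else 0 := by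
    rw [← Pi.single_apply, ← fourierCoeff_fourier (T := 1) 0]
    exact congrArg (fourierCoeff · k) (funext fun _ => fourier_zero.symm)
  have h_smul : fourierCoeff (Function.const Circ x) k =
      fourierCoeff (Function.const Circ (1 : ℂ)) k • x := by
    simp only [fourierCoeff, Function.const_apply, integral_smul_const, smul_eq_mul, mul_one]
  rw [h_smul, h_one, ite_smul, one_smul, zero_smul]

end FourierCoeff

theorem integrable_coeFn {E : Type*} [NormedAddCommGroup E] {p : ℝ≥0∞} [Fact (1 ≤ p)]
    (f : Lp E p (haarAddCircle : Measure Circ)) : Integrable f haarAddCircle :=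
  (Lp.memLp f).integrable Fact.out

theorem hasSum_inner_fourierCoeff_scalar (a b : Lp ℂ 2 (haarAddCircle : Measure Circ)) :
    HasSum (fun k => inner ℂ (fourierCoeff a k) (fourierCoeff b k)) (inner ℂ a b) := by
  refine ((fourierBasis (T := 1)).hasSum_inner_mul_inner a b).congr_fun fun k => ?_
  rw [← inner_conj_symm a, ← HilbertBasis.repr_apply_apply, ← HilbertBasis.repr_apply_apply,
    fourierBasis_repr, fourierBasis_repr, RCLike.inner_apply', mul_comm]

section Hardy

variable {n : ℕ}

theorem L2_ext {f g : L2 n}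
    (h : ∀ᵐ t ∂(haarAddCircle : Measure Circ), (f t).ofLp = (g t).ofLp) : f = g :=
  Lp.ext (h.mono fun _ ht => WithLp.ofLp_injective 2 ht)

theorem hasSum_inner_fourierCoeff (f g : L2 n) :
    HasSum (fun k => inner ℂ (fourierCoeff f k) (fourierCoeff g k)) (inner ℂ f g) := by
  let coord (i : Fin n) (h : L2 n) := (EuclideanSpace.proj (𝕜 := ℂ) i).compLp h
  have coord_ae (i : Fin n) (h : L2 n) :
      ∀ᵐ t ∂(haarAddCircle : Measure Circ), coord i h t = h t i :=
    (EuclideanSpace.proj (𝕜 := ℂ) i).coeFn_compLp h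
  have fourierCoeff_coord (i : Fin n) (h : L2 n) (k : ℤ) :
      fourierCoeff (coord i h) k = fourierCoeff h k i :=
    (fourierCoeff_congr_ae (coord_ae i h) ▸
      fourierCoeff_clm_comp (EuclideanSpace.proj (𝕜 := ℂ) i) (integrable_coeFn h) k :)
  have inner_coord : ∑ i, inner ℂ (coord i f) (coord i g) = inner ℂ f g := by
    simp only [L2.inner_def]
    rw [← integral_finsetSum _ fun i _ => L2.integrable_inner _ _]
    refine integral_congr_ae ?_
    filter_upwards [Filter.eventually_all.2 fun i => coord_ae i f,
      Filter.eventually_all.2 fun i => coord_ae i g] with t hf hg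
    simp only [hf, hg, PiLp.inner_apply]
  have hsum := hasSum_sum (s := Finset.univ) fun i _ =>
    hasSum_inner_fourierCoeff_scalar (coord i f) (coord i g)
  simpa only [fourierCoeff_coord, inner_coord, ← PiLp.inner_apply] using hsum

theorem eq_zero_of_fourierCoeff_eq_zero {f : L2 n} (h : ∀ k : ℤ, fourierCoeff f k = 0) :
    f = 0 := by
  have hsum := hasSum_inner_fourierCoeff f f
  simp only [h, inner_zero_left] at hsum
  exact inner_self_eq_zero.1 (hsum.unique hasSum_zero)

/-- Multiplication by `zᵏ` on `L²(ℂⁿ)`. -/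
noncomputable def shift (k : ℤ) : L2 n →L[ℂ] L2 n :=
  (ContinuousLinearMap.lsmul ℂ ℂ).holderL haarAddCircle ∞ 2 2 (fourierLp ∞ k)

theorem shift_ae (k : ℤ) (f : L2 n) :
    ∀ᵐ t ∂(haarAddCircle : Measure Circ), shift k f t = (fourier k t : ℂ) • f t := by
  filter_upwards [(ContinuousLinearMap.lsmul ℂ ℂ).coeFn_holder (r := 2) (fourierLp ∞ k) f,
    coeFn_fourierLp (T := 1) ∞ k] with t h1 h2
  rw [← h2]
  exact h1

theorem fourierCoeff_shift (p : ℤ) (f : L2 n) (k : ℤ) :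
    fourierCoeff (shift p f) k = fourierCoeff f (k - p) := by
  rw [fourierCoeff_congr_ae (shift_ae p f), fourierCoeff_fourier_smul]

theorem shift_mem_H2 {k : ℤ} (hk : 0 ≤ k) {f : L2 n} (hf : f ∈ H2 n) : shift k f ∈ H2 n :=
  mem_hardy.2 fun j hj => by rw [fourierCoeff_shift, mem_hardy.1 hf _ (by lia)]

/-- The monomial `zᵏ x`, with `x ∈ ℂⁿ`. -/
noncomputable def monomial (k : ℤ) (x : EuclideanSpace ℂ (Fin n)) : L2 n :=
  shift k (Lp.const 2 haarAddCircle x)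

theorem fourierCoeff_monomial (k : ℤ) (x : EuclideanSpace ℂ (Fin n)) (j : ℤ) :
    fourierCoeff (monomial k x) j = if j = k then x else 0 := by
  rw [monomial, fourierCoeff_shift, fourierCoeff_congr_ae (Lp.coeFn_const _ _ x)]
  simp only [fourierCoeff_const, sub_eq_zero]

theorem monomial_mem_H2 {k : ℤ} (hk : 0 ≤ k) (x : EuclideanSpace ℂ (Fin n)) :
    monomial k x ∈ H2 n :=
  mem_hardy.2 fun j hj => by rw [fourierCoeff_monomial, if_neg (by lia)]

theorem inner_monomial (k : ℤ) (x : EuclideanSpace ℂ (Fin n)) (f : L2 n) :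
    inner ℂ (monomial k x) f = inner ℂ x (fourierCoeff f k) := by
  have h := hasSum_single (f := fun j => inner ℂ (fourierCoeff (monomial k x) j) (fourierCoeff f j))
    k fun j hj => by rw [fourierCoeff_monomial, if_neg hj, inner_zero_left]
  rw [(hasSum_inner_fourierCoeff _ f).unique h, fourierCoeff_monomial, if_pos rfl]

theorem mem_H2minus_of_inner_monomial {f : L2 n}
    (h : ∀ k : ℤ, 0 ≤ k → ∀ x, inner ℂ (monomial k x) f = 0) : f ∈ H2minus n := by
  refine (Submodule.mem_orthogonal _ _).2 fun g hg => ?_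
  refine (hasSum_inner_fourierCoeff g f).unique ?_
  convert hasSum_zero using 2 with j
  rcases lt_or_ge j 0 with hj | hj
  · rw [mem_hardy.1 hg j hj, inner_zero_left]
  · exact (inner_monomial j _ f).symm.trans (h j hj _)

theorem mem_H2minus_iff {f : L2 n} :
    f ∈ H2minus n ↔ ∀ k : ℤ, 0 ≤ k → fourierCoeff f k = 0 := by
  refine ⟨fun h k hk => ?_, fun h => mem_H2minus_of_inner_monomial fun k hk x => ?_⟩
  · rw [← inner_self_eq_zero (𝕜 := ℂ), ← inner_monomial]
    exact (Submodule.mem_orthogonal _ _).1 h _ (monomial_mem_H2 hk _)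
  · rw [inner_monomial, h k hk, inner_zero_right]

theorem mem_H2_iff_forall_inner_H2minus {f : L2 n} :
    f ∈ H2 n ↔ ∀ g ∈ H2minus n, inner ℂ g f = 0 := by
  rw [← Submodule.mem_orthogonal, Submodule.orthogonal_orthogonal]

end Hardy

/-! ### Multiplication operators -/

section MulOp

variable {m n l : ℕ}

theorem norm_mulOp_apply_le (Φ : Linfty m n) (f : L2 n) : ‖mulOp Φ f‖ ≤ ‖Φ‖ * ‖f‖ := by
  have hnorm : ‖mulVecBilin m n‖ ≤ 1 :=
    ContinuousLinearMap.opNorm_le_bound₂ _ zero_le_one fun A x =>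
      (Matrix.l2_opNorm_mulVec A x).trans_eq (by rw [one_mul])
  refine ((mulVecBilin m n).norm_holder_apply_apply_le (r := 2) Φ f).trans ?_
  rw [mul_assoc]
  exact mul_le_of_le_one_left (by positivity) hnorm

theorem mulOp_apply_ae (Φ : Linfty m n) (f : L2 n) :
    ∀ᵐ t ∂(haarAddCircle : Measure Circ), ∀ i, mulOp Φ f t i = ∑ j, f t j * Φ t i j := by
  filter_upwards [mulOp_ae Φ f] with t ht i
  rw [ht, Matrix.mulVec_eq_sum]
  simp

theorem mulOp_mulOp_ae (Φ : Linfty l m) (Ψ : Linfty m n) (f : L2 n) :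
    ∀ᵐ t ∂(haarAddCircle : Measure Circ),
      (mulOp Φ (mulOp Ψ f) t).ofLp = (Φ t * Ψ t) *ᵥ (f t).ofLp := by
  filter_upwards [mulOp_ae Φ (mulOp Ψ f), mulOp_ae Ψ f] with t hΦ hΨ
  rw [hΦ, hΨ, Matrix.mulVec_mulVec]

theorem mulOp_shift (Φ : Linfty m n) (k : ℤ) (f : L2 n) :
    mulOp Φ (shift k f) = shift k (mulOp Φ f) := by
  refine L2_ext ?_
  filter_upwards [mulOp_ae Φ (shift k f), shift_ae k f, shift_ae k (mulOp Φ f), mulOp_ae Φ f]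
    with t h1 h2 h3 h4
  rw [h1, h2, h3, WithLp.ofLp_smul, WithLp.ofLp_smul, h4, Matrix.mulVec_smul]

theorem fourierCoeff_mulOp_monomial (Φ : Linfty m n) (k : ℤ) (x : EuclideanSpace ℂ (Fin n))
    (j : ℤ) : fourierCoeff (mulOp Φ (monomial k x)) j =
      mulVecBilin m n (fourierCoeff Φ (j - k)) x := by
  have h_const : ∀ᵐ t ∂(haarAddCircle : Measure Circ),
      mulOp Φ (Lp.const 2 haarAddCircle x) t = (mulVecBilin m n).flip x (Φ t) := by
    filter_upwards [(mulVecBilin m n).coeFn_holder (r := 2) Φ (Lp.const 2 haarAddCircle x),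
      Lp.coeFn_const 2 haarAddCircle x] with t h1 h2
    rw [h2] at h1
    exact h1
  rw [monomial, mulOp_shift, fourierCoeff_shift, fourierCoeff_congr_ae h_const,
    fourierCoeff_clm_comp _ (integrable_coeFn Φ), ContinuousLinearMap.flip_apply]

theorem transp_mem_Hinfty {Φ : Linfty m n} (hΦ : Φ ∈ Hinfty m n) : transp Φ ∈ Hinfty n m := by
  refine mem_hardy.2 fun k hk => ?_
  have h := fourierCoeff_clm_comp (LinearMap.toContinuousLinearMap
    (Matrix.transposeLinearEquiv (Fin m) (Fin n) ℂ ℂ).toLinearMap) (integrable_coeFn Φ) k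
  rw [mem_hardy.1 hΦ k hk, map_zero] at h
  rwa [fourierCoeff_congr_ae (transp_ae Φ)]

/-- Entrywise complex conjugation of matrices, as a continuous conjugate-linear map. -/
noncomputable def conjMatrixCLM (m n : ℕ) :
    Matrix (Fin m) (Fin n) ℂ →SL[starRingEnd ℂ] Matrix (Fin m) (Fin n) ℂ where
  toFun A := A.map star
  map_add' A B := by ext; simp
  map_smul' c A := by ext; simp
  cont := continuous_id.matrix_map continuous_star

/-- The entrywise complex conjugate `Φ̄` of a matrix function. -/
noncomputable def conjEntries (Φ : Linfty m n) : Linfty m n := (conjMatrixCLM m n).compLp Φ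

theorem conjEntries_ae (Φ : Linfty m n) :
    ∀ᵐ t ∂(haarAddCircle : Measure Circ), conjEntries Φ t = (Φ t).map star :=
  (conjMatrixCLM m n).coeFn_compLp Φ

/-- The pointwise adjoint `Φ*` of a matrix function. -/
noncomputable def conjTransp (Φ : Linfty m n) : Linfty n m := transp (conjEntries Φ)

theorem conjTransp_ae (Φ : Linfty m n) :
    ∀ᵐ t ∂(haarAddCircle : Measure Circ), conjTransp Φ t = (Φ t)ᴴ := by
  filter_upwards [transp_ae (conjEntries Φ), conjEntries_ae Φ] with t h1 h2
  rw [conjTransp, h1, h2]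
  rfl

theorem mulOp_transp_eq_zero_iff {Φ : Linfty m n} {f : L2 m} :
    mulOp (transp Φ) f = 0 ↔
      ∀ᵐ t ∂(haarAddCircle : Measure Circ), (Φ t)ᵀ *ᵥ (f t).ofLp = 0 := by
  rw [Lp.eq_zero_iff_ae_eq_zero]
  refine Filter.eventually_congr ?_
  filter_upwards [mulOp_ae (transp Φ) f, transp_ae Φ] with t h1 h2
  rw [← h2, ← h1]
  exact (WithLp.ofLp_eq_zero 2).symm

theorem transp_transp (Φ : Linfty m n) : transp (transp Φ) = Φ := by
  refine Lp.ext ?_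
  filter_upwards [transp_ae (transp Φ), transp_ae Φ] with t h1 h2
  rw [h1, h2, Matrix.transpose_transpose]

theorem conjEntries_conjEntries (Φ : Linfty m n) : conjEntries (conjEntries Φ) = Φ := by
  refine Lp.ext ?_
  filter_upwards [conjEntries_ae (conjEntries Φ), conjEntries_ae Φ] with t h1 h2
  rw [h1, h2]
  ext i j
  simp

theorem conjEntries_transp (Φ : Linfty m n) : conjEntries (transp Φ) = conjTransp Φ := by
  refine Lp.ext ?_
  filter_upwards [conjEntries_ae (transp Φ), transp_ae Φ, conjTransp_ae Φ] with t h1 h2 h3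
  rw [h1, h2, h3]
  rfl

theorem conjTransp_conjEntries (Φ : Linfty m n) : conjTransp (conjEntries Φ) = transp Φ := by
  rw [conjTransp, conjEntries_conjEntries]

theorem conjTransp_transp (Φ : Linfty m n) : conjTransp (transp Φ) = conjEntries Φ := by
  rw [← conjEntries_transp, transp_transp]

theorem conjTransp_conjTransp (Φ : Linfty m n) : conjTransp (conjTransp Φ) = Φ := by
  rw [← conjEntries_transp Φ, conjTransp_conjEntries, transp_transp]

theorem inner_mulOp_left (Φ : Linfty m n) (f : L2 n) (g : L2 m) :
    inner ℂ (mulOp Φ f) g = inner ℂ f (mulOp (conjTransp Φ) g) := by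
  rw [L2.inner_def, L2.inner_def]
  refine integral_congr_ae ?_
  filter_upwards [mulOp_ae Φ f, mulOp_ae (conjTransp Φ) g, conjTransp_ae Φ] with t h1 h2 h3
  rw [EuclideanSpace.inner_eq_star_dotProduct, EuclideanSpace.inner_eq_star_dotProduct, h1, h2, h3,
    Matrix.star_mulVec, dotProduct_comm, ← Matrix.dotProduct_mulVec, dotProduct_comm]

theorem inner_mulOp_right (Φ : Linfty m n) (f : L2 n) (g : L2 m) :
    inner ℂ g (mulOp Φ f) = inner ℂ (mulOp (conjTransp Φ) g) f := by
  rw [inner_mulOp_left, conjTransp_conjTransp]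

theorem mulOp_mem_H2minus {Φ : Linfty m n} (hΦ : conjTransp Φ ∈ Hinfty n m) {f : L2 n}
    (hf : f ∈ H2minus n) : mulOp Φ f ∈ H2minus m := by
  refine mem_H2minus_of_inner_monomial fun k hk x => ?_
  rw [inner_mulOp_right]
  refine (Submodule.mem_orthogonal _ _).1 hf _ (mem_hardy.2 fun j hj => ?_)
  rw [fourierCoeff_mulOp_monomial, mem_hardy.1 hΦ _ (by lia), map_zero,
    zero_apply]

theorem mulOp_mem_H2 {Φ : Linfty m n} (hΦ : Φ ∈ Hinfty m n) {f : L2 n} (hf : f ∈ H2 n) :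
    mulOp Φ f ∈ H2 m := by
  refine mem_H2_iff_forall_inner_H2minus.2 fun g hg => ?_
  rw [inner_mulOp_right]
  rw [← conjTransp_conjTransp Φ] at hΦ
  exact mem_H2_iff_forall_inner_H2minus.1 hf _ (mulOp_mem_H2minus hΦ hg)

/-- Multiplication by a bounded analytic matrix function, as an operator between Hardy spaces. -/
noncomputable def mulH2 {Φ : Linfty m n} (hΦ : Φ ∈ Hinfty m n) : H2 n →L[ℂ] H2 m :=
  (mulOp Φ).restrict fun _ => mulOp_mem_H2 hΦ

theorem coe_mulH2 {Φ : Linfty m n} (hΦ : Φ ∈ Hinfty m n) (f : H2 n) :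
    (mulH2 hΦ f : L2 m) = mulOp Φ f := rfl

end MulOp

/-- The matrix function `Φ` is isometric-valued: `Φ* Φ = I` a.e. -/
def IsIsometric {m n : ℕ} (Φ : Linfty m n) : Prop :=
  ∀ᵐ t ∂(haarAddCircle : Measure Circ), (Φ t)ᴴ * Φ t = 1

namespace IsIsometric

variable {m n : ℕ} {Φ : Linfty m n}

theorem conjTransp_mulOp (h : IsIsometric Φ) (f : L2 n) :
    mulOp (conjTransp Φ) (mulOp Φ f) = f := by
  refine L2_ext ?_
  filter_upwards [h, mulOp_mulOp_ae (conjTransp Φ) Φ f, conjTransp_ae Φ] with t h1 h2 h3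
  rw [h2, h3, h1, Matrix.one_mulVec]

theorem injective_mulOp (h : IsIsometric Φ) : Function.Injective (mulOp Φ) :=
  Function.LeftInverse.injective h.conjTransp_mulOp

theorem norm_mulOp (h : IsIsometric Φ) (f : L2 n) : ‖mulOp Φ f‖ = ‖f‖ := by
  rw [@norm_eq_sqrt_re_inner ℂ, @norm_eq_sqrt_re_inner ℂ, inner_mulOp_left, h.conjTransp_mulOp]

theorem conjEntries (h : IsIsometric Φ) : IsIsometric (conjEntries Φ) := by
  filter_upwards [h, conjEntries_ae Φ] with t h1 h2
  have h3 := congrArg Matrix.transpose h1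
  rw [Matrix.transpose_mul, Matrix.transpose_one] at h3
  have h4 : ((Φ t).map star)ᴴ = (Φ t)ᵀ := Matrix.ext fun _ _ => star_star _
  rw [h2, h4]
  exact h3

end IsIsometric

theorem IsInner.isIsometric {m n : ℕ} {Θ : Linfty m n} (h : IsInner Θ) : IsIsometric Θ := h.2

theorem IsUnimodular.isIsometric {u : Linfty 1 1} (hu : IsUnimodular u) : IsIsometric u := by
  filter_upwards [hu] with t ht
  ext i j
  rw [Subsingleton.elim i 0, Subsingleton.elim j 0]
  simp [Matrix.mul_apply, Complex.conj_mul', ht]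

/-! ### The conjugation `f ↦ z̄ f̄` and outer functions -/

section Conjugation

variable {m n : ℕ}

/-- Coordinatewise complex conjugation on `ℂⁿ`, as a continuous conjugate-linear map. -/
noncomputable def conjVecCLM (n : ℕ) :
    EuclideanSpace ℂ (Fin n) →SL[starRingEnd ℂ] EuclideanSpace ℂ (Fin n) where
  toFun x := WithLp.toLp 2 (star x.ofLp)
  map_add' x y := by ext; simp
  map_smul' c x := by ext; simp
  cont := by fun_prop

/-- The conjugation `f ↦ z̄ f̄` of `L²(ℂⁿ)`, which interchanges `H²` and `H²₋`. -/
noncomputable def zbarConj (n : ℕ) : L2 n →SL[starRingEnd ℂ] L2 n :=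
  (shift (-1)).comp ((conjVecCLM n).compLpL 2 haarAddCircle)

theorem zbarConj_ae (f : L2 n) :
    ∀ᵐ t ∂(haarAddCircle : Measure Circ),
      zbarConj n f t = (fourier (-1) t : ℂ) • conjVecCLM n (f t) := by
  filter_upwards [shift_ae (-1) ((conjVecCLM n).compLpL 2 haarAddCircle f),
    (conjVecCLM n).coeFn_compLpL f] with t h1 h2
  rwa [h2] at h1

theorem fourierCoeff_zbarConj (f : L2 n) (k : ℤ) :
    fourierCoeff (zbarConj n f) k = conjVecCLM n (fourierCoeff f (-1 - k)) := by
  have h_int := (conjVecCLM n).integral_comp_commSL (by simp)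
    ((integrable_coeFn f).fourier_smul (k + 1))
  rw [fourierCoeff_congr_ae (zbarConj_ae f), fourierCoeff_fourier_smul]
  simp only [fourierCoeff, sub_neg_eq_add, neg_sub_left, neg_neg]
  simpa only [map_smulₛₗ, ← fourier_neg, add_comm 1 k] using h_int

theorem zbarConj_zbarConj (f : L2 n) : zbarConj n (zbarConj n f) = f := by
  refine Lp.ext ?_
  filter_upwards [zbarConj_ae f, zbarConj_ae (zbarConj n f)] with t h1 h2
  have h_conj (x : EuclideanSpace ℂ (Fin n)) : conjVecCLM n (conjVecCLM n x) = x :=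
    WithLp.ofLp_injective 2 (star_star _)
  rw [h2, h1, map_smulₛₗ, ← fourier_neg, smul_smul, ← fourier_add, h_conj, add_neg_cancel,
    fourier_zero, one_smul]

theorem zbarConj_mem_H2minus {f : L2 n} (hf : f ∈ H2 n) : zbarConj n f ∈ H2minus n :=
  mem_H2minus_iff.2 fun k hk => by
    rw [fourierCoeff_zbarConj, mem_hardy.1 hf _ (by lia), map_zero]

theorem zbarConj_mem_H2 {f : L2 n} (hf : f ∈ H2minus n) : zbarConj n f ∈ H2 n :=
  mem_hardy.2 fun k hk => by
    rw [fourierCoeff_zbarConj, mem_H2minus_iff.1 hf _ (by lia), map_zero]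

theorem zbarConj_mulOp (Φ : Linfty m n) (f : L2 n) :
    zbarConj m (mulOp Φ f) = mulOp (conjEntries Φ) (zbarConj n f) := by
  refine L2_ext ?_
  filter_upwards [zbarConj_ae f, zbarConj_ae (mulOp Φ f), mulOp_ae Φ f,
    mulOp_ae (conjEntries Φ) (zbarConj n f), conjEntries_ae Φ] with t h1 h2 h3 h4 h5
  rw [h2, h4, h1, h5, WithLp.ofLp_smul, WithLp.ofLp_smul, Matrix.mulVec_smul]
  congr 1
  ext i
  simp [conjVecCLM, h3, Matrix.mulVec, dotProduct]

end Conjugation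

namespace IsOuter

variable {m n : ℕ} {F : Linfty m n}

theorem subset_closure (hF : IsOuter F) :
    (H2 m : Set (L2 m)) ⊆ closure (mulOp F '' (H2 n : Set (L2 n))) :=
  hF.2.ge

theorem subset_closure_conjEntries (hF : IsOuter F) :
    (H2minus m : Set (L2 m)) ⊆
      closure (mulOp (conjEntries F) '' (H2minus n : Set (L2 n))) := by
  intro g hg
  have h := mem_closure_image (zbarConj m).continuous.continuousAt
    (hF.subset_closure (zbarConj_mem_H2 hg))
  rw [zbarConj_zbarConj] at h
  refine closure_mono ?_ h
  rintro _ ⟨_, ⟨f, hf, rfl⟩, rfl⟩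
  exact ⟨zbarConj n f, zbarConj_mem_H2minus hf, (zbarConj_mulOp F f).symm⟩

end IsOuter

namespace IsCoOuter

variable {m n : ℕ} {Φ : Linfty m n} {x : L2 n}

theorem mem_H2minus_of_conjEntries_mulOp (hΦ : IsCoOuter Φ)
    (hx : mulOp (conjEntries Φ) x ∈ H2minus m) : x ∈ H2minus n := by
  refine (Submodule.mem_orthogonal _ _).2 fun g hg => ?_
  refine closure_minimal (t := {s | inner ℂ s x = 0}) ?_
    (isClosed_eq (continuous_id.inner continuous_const) continuous_const) (hΦ.subset_closure hg)
  rintro _ ⟨h, hh, rfl⟩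
  rw [Set.mem_ofPred_eq, inner_mulOp_left, conjTransp_transp]
  exact (Submodule.mem_orthogonal _ _).1 hx _ hh

theorem mem_H2_of_mulOp (hΦ : IsCoOuter Φ) (hx : mulOp Φ x ∈ H2 m) : x ∈ H2 n := by
  have h := zbarConj_mem_H2minus hx
  rw [zbarConj_mulOp] at h
  rw [← zbarConj_zbarConj x]
  exact zbarConj_mem_H2 (hΦ.mem_H2minus_of_conjEntries_mulOp h)

end IsCoOuter

/-! ### Operators whose essential norm is smaller than their norm -/

section Defect

open Filter Topology

variable {D : Type*} {E F : Type} [NormedAddCommGroup D] [NormedSpace ℂ D]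
  [NormedAddCommGroup E] [InnerProductSpace ℂ E] [NormedAddCommGroup F] [InnerProductSpace ℂ F]

theorem exists_isCompactOperator_norm_sub_lt {T : E →L[ℂ] F} {r : ℝ} (h : essNorm T < r) :
    ∃ K : E →L[ℂ] F, IsCompactOperator K ∧ ‖T - K‖ < r := by
  have h_nonempty : {r : ℝ | ∃ K : E →L[ℂ] F, IsCompactOperator K ∧ r = ‖T - K‖}.Nonempty :=
    ⟨_, 0, isCompactOperator_zero, rfl⟩
  obtain ⟨_, ⟨K, hK, rfl⟩, hr⟩ := exists_lt_of_csInf_lt h_nonempty h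
  exact ⟨K, hK, hr⟩

/-- The defect `‖T‖² ‖x‖² - ‖T x‖²`, a nonnegative quadratic form that vanishes precisely on the
maximizing vectors of `T`. -/
noncomputable def defect (T : E →L[ℂ] F) (x : E) : ℝ := ‖T‖ ^ 2 * ‖x‖ ^ 2 - ‖T x‖ ^ 2

theorem continuous_defect (T : E →L[ℂ] F) : Continuous (defect T) := by
  unfold defect
  fun_prop

theorem defect_nonneg (T : E →L[ℂ] F) (x : E) : 0 ≤ defect T x := by
  rw [defect, ← mul_pow]
  exact sub_nonneg.2 (pow_le_pow_left₀ (norm_nonneg _) (T.le_opNorm x) 2)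

theorem defect_smul (T : E →L[ℂ] F) (c : ℂ) (x : E) : defect T (c • x) = ‖c‖ ^ 2 * defect T x := by
  simp only [defect, map_smul, norm_smul]
  ring

theorem mem_maximizing_iff_defect_eq_zero {T : E →L[ℂ] F} {x : E} :
    x ∈ maximizing T ↔ defect T x = 0 := by
  rw [defect, ← mul_pow, sub_eq_zero, pow_left_inj₀ (by positivity) (norm_nonneg _) two_ne_zero,
    eq_comm]
  rfl

theorem isClosed_maximizing (T : E →L[ℂ] F) : IsClosed (maximizing T : Set E) := by
  have h : (maximizing T : Set E) = defect T ⁻¹' {0} :=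
    Set.ext fun _ => mem_maximizing_iff_defect_eq_zero
  rw [h]
  exact isClosed_singleton.preimage (continuous_defect T)

/-- The parallelogram law for `‖T‖² ‖·‖² - ‖T ·‖²`, with the term `defect T (x + y) ≥ 0`
dropped. -/
theorem defect_sub_le (T : E →L[ℂ] F) (x y : E) :
    defect T (x - y) ≤ 2 * defect T x + 2 * defect T y := by
  have h1 := parallelogram_law_with_norm ℂ (T x) (T y)
  have h2 := congrArg (‖T‖ ^ 2 * ·) (parallelogram_law_with_norm ℂ x y)
  have h3 := defect_nonneg T (x + y)
  simp only [defect, map_add, map_sub] at h1 h2 h3 ⊢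
  linarith

theorem opNorm_mul_norm_le (T : E →L[ℂ] F) (x : E) :
    ‖T‖ * ‖x‖ ≤ ‖T x‖ + √(defect T x) := by
  refine abs_le_of_sq_le_sq' ?_ (by positivity) |>.2
  have h_cross : 0 ≤ ‖T x‖ * √(defect T x) := by positivity
  have h_defect : defect T x = ‖T‖ ^ 2 * ‖x‖ ^ 2 - ‖T x‖ ^ 2 := rfl
  rw [add_sq, Real.sq_sqrt (defect_nonneg T x), mul_pow]
  linarith

theorem exists_subseq_tendsto_of_defect [CompleteSpace E] {T : E →L[ℂ] F} (hT : essNorm T < ‖T‖)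
    {y : ℕ → E} {R : ℝ} (hy : ∀ k, ‖y k‖ ≤ R)
    (hd : Tendsto (fun k => defect T (y k)) atTop (𝓝 0)) :
    ∃ x, ∃ φ : ℕ → ℕ, StrictMono φ ∧ Tendsto (y ∘ φ) atTop (𝓝 x) := by
  obtain ⟨K, hK, hr⟩ := exists_isCompactOperator_norm_sub_lt hT
  obtain ⟨z, -, φ, hφ, hz⟩ := (hK.isCompact_closure_image_closedBall R).tendsto_subseq
    (x := fun k => K (y k)) fun k => subset_closure ⟨y k, by simpa using hy k, rfl⟩
  suffices h : CauchySeq (y ∘ φ) from (cauchySeq_tendsto_of_complete h).imp fun x hx => ⟨φ, hφ, hx⟩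
  have h_lower (x : E) : (‖T‖ - ‖T - K‖) * ‖x‖ ≤ ‖K x‖ + √(defect T x) := by
    have h1 := opNorm_mul_norm_le T x
    have h2 : ‖T x‖ ≤ ‖(T - K) x‖ + ‖K x‖ := by simpa using norm_add_le ((T - K) x) (K x)
    linarith [(T - K).le_opNorm x]
  have hd' := hd.comp hφ.tendsto_atTop
  have h_bound : Tendsto (fun p : ℕ × ℕ => (dist (K (y (φ p.1))) (K (y (φ p.2))) +
      √(2 * defect T (y (φ p.1)) + 2 * defect T (y (φ p.2)))) / (‖T‖ - ‖T - K‖))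
      atTop (𝓝 0) := by
    have h1 := cauchySeq_iff_tendsto_dist_atTop_0.1 hz.cauchySeq
    have h2 := ((hd'.comp tendsto_fst).const_mul 2).add ((hd'.comp tendsto_snd).const_mul 2)
    rw [prod_atTop_atTop_eq] at h2
    simpa using (h1.add h2.sqrt).div_const (‖T‖ - ‖T - K‖)
  refine cauchySeq_iff_tendsto_dist_atTop_0.2 (squeeze_zero (fun _ => dist_nonneg) (fun p => ?_)
    h_bound)
  rw [le_div_iff₀' (sub_pos.2 hr), dist_eq_norm, dist_eq_norm, ← map_sub]
  exact (h_lower _).trans (add_le_add_right (Real.sqrt_le_sqrt (defect_sub_le T _ _)) _)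

theorem finiteDimensional_maximizing [CompleteSpace E] {T : E →L[ℂ] F} (hT : essNorm T < ‖T‖) :
    FiniteDimensional ℂ (maximizing T) := by
  refine FiniteDimensional.of_isCompact_closedBall ℂ one_pos (c := (0 : maximizing T)) ?_
  refine IsSeqCompact.isCompact fun y hy => ?_
  have hd : ∀ k, defect T (y k) = 0 := fun k => mem_maximizing_iff_defect_eq_zero.1 (y k).2
  obtain ⟨x, φ, hφ, hx⟩ := exists_subseq_tendsto_of_defect hT
    (y := fun k => (y k : E)) (fun k => mem_closedBall_zero_iff.1 (hy k)) (by simp [hd])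
  have hx_mem : x ∈ maximizing T :=
    (isClosed_maximizing T).mem_of_tendsto hx (Eventually.of_forall fun k => (y (φ k)).2)
  have hx' : Tendsto (y ∘ φ) atTop (𝓝 ⟨x, hx_mem⟩) := tendsto_subtype_rng.2 hx
  exact ⟨⟨x, hx_mem⟩, Metric.isClosed_closedBall.mem_of_tendsto hx'
    (Eventually.of_forall fun k => hy (φ k)), φ, hφ, hx'⟩

theorem exists_pos_mul_norm_sq_le_defect [CompleteSpace E] {T : E →L[ℂ] F}
    (hT : essNorm T < ‖T‖) :
    ∃ c > 0, ∀ x ∈ (maximizing T)ᗮ, c * ‖x‖ ^ 2 ≤ defect T x := by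
  by_contra! h
  have h_unit (k : ℕ) : ∃ y ∈ (maximizing T)ᗮ, ‖y‖ = 1 ∧ defect T y ≤ 1 / ((k : ℝ) + 1) := by
    obtain ⟨x, hx, hlt⟩ := h (1 / ((k : ℝ) + 1)) Nat.one_div_pos_of_nat
    have hx0 : x ≠ 0 := by
      rintro rfl
      simp [defect] at hlt
    refine ⟨(‖x‖⁻¹ : ℂ) • x, Submodule.smul_mem _ _ hx, norm_smul_inv_norm hx0, ?_⟩
    rw [defect_smul, norm_inv, Complex.norm_real, norm_norm, inv_pow,
      inv_mul_le_iff₀ (by positivity), mul_comm]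
    exact hlt.le
  choose y hy_mem hy_norm hy_defect using h_unit
  have hd : Tendsto (fun k => defect T (y k)) atTop (𝓝 0) :=
    squeeze_zero (fun k => defect_nonneg T (y k)) hy_defect tendsto_one_div_add_atTop_nhds_zero_nat
  obtain ⟨x, φ, hφ, hx⟩ := exists_subseq_tendsto_of_defect hT (fun k => (hy_norm k).le) hd
  have hx_norm : ‖x‖ = 1 := tendsto_nhds_unique hx.norm (by simp [hy_norm])
  have hx_max : x ∈ maximizing T := mem_maximizing_iff_defect_eq_zero.2 <|
    tendsto_nhds_unique (((continuous_defect T).tendsto x).comp hx) (hd.comp hφ.tendsto_atTop)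
  have hx_orth : x ∈ (maximizing T)ᗮ :=
    (Submodule.isClosed_orthogonal _).mem_of_tendsto hx (Eventually.of_forall fun k => hy_mem _)
  have hx0 : x = 0 := inner_self_eq_zero.1 ((Submodule.mem_orthogonal _ _).1 hx_orth x hx_max)
  rw [hx0, norm_zero] at hx_norm
  exact zero_ne_one hx_norm

theorem maximizing_ne_bot [CompleteSpace E] {T : E →L[ℂ] F} (hT : essNorm T < ‖T‖) :
    maximizing T ≠ ⊥ := by
  intro h_bot
  obtain ⟨K, -, hK⟩ := exists_isCompactOperator_norm_sub_lt hT
  obtain ⟨c, hc, h_le⟩ := exists_pos_mul_norm_sq_le_defect hT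
  have h_norm : ‖T‖ ≤ √(‖T‖ ^ 2 - c) := T.opNorm_le_bound (Real.sqrt_nonneg _) fun x => by
    rw [← Real.sqrt_sq (norm_nonneg x), ← Real.sqrt_mul' _ (by positivity)]
    refine Real.le_sqrt_of_sq_le ?_
    have := h_le x (by simp [h_bot])
    rw [defect] at this
    linarith
  linarith [(Real.le_sqrt' ((norm_nonneg _).trans_lt hK)).1 h_norm]

theorem mem_map_maximizing_of_tendsto [CompleteSpace E] {T : E →L[ℂ] F} (hT : essNorm T < ‖T‖)
    (S : E →L[ℂ] D) {f : ℕ → E} {g : D} (hf : Tendsto (fun k => S (f k)) atTop (𝓝 g))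
    (hd : Tendsto (fun k => defect T (f k)) atTop (𝓝 0)) :
    g ∈ (maximizing T).map S.toLinearMap := by
  have := finiteDimensional_maximizing hT
  obtain ⟨c, hc, h_le⟩ := exists_pos_mul_norm_sq_le_defect hT
  let P := (maximizing T).starProjection
  have hP (x : E) : P x ∈ maximizing T := (maximizing T).starProjection_apply_mem x
  have h_rest : Tendsto (fun k => f k - P (f k)) atTop (𝓝 0) := by
    have h_sq (k : ℕ) : ‖f k - P (f k)‖ ^ 2 ≤ 2 * defect T (f k) / c := by
      rw [le_div_iff₀' hc]
      refine (h_le _ ((maximizing T).sub_starProjection_mem_orthogonal _)).trans ?_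
      simpa [mem_maximizing_iff_defect_eq_zero.1 (hP (f k))] using defect_sub_le T (f k) (P (f k))
    refine tendsto_zero_iff_norm_tendsto_zero.2 (squeeze_zero (fun _ => norm_nonneg _)
      (fun k => Real.le_sqrt_of_sq_le (h_sq k)) ?_)
    simpa using ((hd.const_mul 2).div_const c).sqrt
  have h_proj : Tendsto (fun k => S (P (f k))) atTop (𝓝 g) := by
    simpa using hf.sub ((S.continuous.tendsto 0).comp h_rest)
  exact ((maximizing T).map S.toLinearMap).closed_of_finiteDimensional.mem_of_tendsto h_proj
    (Eventually.of_forall fun k => Submodule.mem_map_of_mem (hP _))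

end Defect

/-! ### Hankel and Toeplitz operators -/

section Toeplitz

variable {m n : ℕ} (Φ : Linfty m n) (f : H2 n)

theorem toeplitz_add_hankel : (toeplitz Φ f : L2 m) + hankel Φ f = mulOp Φ f :=
  (H2 m).starProjection_add_starProjection_orthogonal _

theorem norm_sq_toeplitz_add_norm_sq_hankel :
    ‖toeplitz Φ f‖ ^ 2 + ‖hankel Φ f‖ ^ 2 = ‖mulOp Φ f‖ ^ 2 :=
  (Submodule.norm_sq_eq_add_norm_sq_projection _ (H2 m)).symm

theorem norm_hankel_apply_le : ‖hankel Φ f‖ ≤ ‖mulOp Φ f‖ :=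
  (H2minus m).norm_orthogonalProjectionOnto_apply_le _

theorem norm_hankel_le : ‖hankel Φ‖ ≤ ‖Φ‖ :=
  ContinuousLinearMap.opNorm_le_bound _ (norm_nonneg _) fun f =>
    (norm_hankel_apply_le Φ f).trans (norm_mulOp_apply_le Φ f)

variable {Φ f}

theorem toeplitz_eq_zero_iff : toeplitz Φ f = 0 ↔ mulOp Φ f ∈ H2minus m := by
  rw [← Submodule.orthogonalProjectionOnto_eq_zero_iff]
  rfl

theorem norm_toeplitz_le_of_sub_mem_H2minus {r : L2 m} (h : mulOp Φ f - r ∈ H2minus m) :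
    ‖toeplitz Φ f‖ ≤ ‖r‖ := by
  have h_eq : toeplitz Φ f = (H2 m).orthogonalProjectionOnto r := by
    rw [← sub_eq_zero, ← Submodule.orthogonalProjectionOnto_eq_zero_iff.2 h, map_sub]
    rfl
  exact h_eq ▸ (H2 m).norm_orthogonalProjectionOnto_apply_le r

theorem exists_mulOp_sub_mem_H2minus (hΦ : (toeplitz Φ).range = ⊤) (b : L2 m) :
    ∃ ξ : H2 n, mulOp Φ ξ - b ∈ H2minus m := by
  obtain ⟨ξ, hξ⟩ := LinearMap.range_eq_top.1 hΦ ((H2 m).orthogonalProjectionOnto b)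
  refine ⟨ξ, Submodule.orthogonalProjectionOnto_eq_zero_iff.1 ?_⟩
  rw [map_sub, sub_eq_zero]
  exact hξ

theorem norm_hankel_eq_iff (h : ‖mulOp Φ f‖ ≤ ‖f‖) :
    ‖hankel Φ f‖ = ‖f‖ ↔ mulOp Φ f ∈ H2minus m ∧ ‖mulOp Φ f‖ = ‖f‖ := by
  have h_sq := norm_sq_toeplitz_add_norm_sq_hankel Φ f
  constructor
  · intro hf
    have h_norm : ‖mulOp Φ f‖ = ‖f‖ := h.antisymm (hf ▸ norm_hankel_apply_le Φ f)
    refine ⟨toeplitz_eq_zero_iff.1 ?_, h_norm⟩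
    rwa [hf, h_norm, add_eq_right, sq_eq_zero_iff, norm_eq_zero] at h_sq
  · rintro ⟨h_mem, h_norm⟩
    rw [toeplitz_eq_zero_iff.2 h_mem, norm_zero, zero_pow two_ne_zero, zero_add] at h_sq
    rw [← h_norm]
    exact (pow_left_inj₀ (norm_nonneg _) (norm_nonneg _) two_ne_zero).1 h_sq

theorem mem_maxVectors_iff (h : ‖hankel Φ‖ = 1) : f ∈ maxVectors Φ ↔ ‖hankel Φ f‖ = ‖f‖ := by
  have h_mul : ‖hankel Φ‖ * ‖f‖ = ‖f‖ := by rw [h, one_mul]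
  rw [← h_mul]
  rfl

theorem mem_maxVectors_of_norm_le_one (h : ‖Φ‖ ≤ 1) (hf : ‖hankel Φ f‖ = ‖f‖) :
    f ∈ maxVectors Φ := by
  refine ((hankel Φ).le_opNorm f).antisymm ?_
  rw [hf]
  exact mul_le_of_le_one_left (norm_nonneg f) ((norm_hankel_le Φ).trans h)

end Toeplitz

/-! ### Coburn's lemma and invertibility of Toeplitz operators -/

section Fredholm

variable {E F : Type} [NormedAddCommGroup E] [NormedSpace ℂ E]
  [NormedAddCommGroup F] [NormedSpace ℂ F] {T : E →L[ℂ] F}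

theorem ker_eq_bot_of_fredholmIndex_nonpos (hT : T.IsFredholm) (h_index : fredholmIndex T ≤ 0)
    (h_range : T.range = ⊤) : T.ker = ⊥ := by
  have := hT.finite_ker
  have := Submodule.Quotient.subsingleton_iff.2 h_range
  rw [fredholmIndex, Module.finrank_zero_of_subsingleton (M := F ⧸ T.range)] at h_index
  exact Submodule.finrank_eq_zero.1 (by lia)

theorem range_eq_top_of_fredholmIndex_eq_zero (hT : T.IsFredholm) (h_index : fredholmIndex T = 0)
    (h_ker : T.ker = ⊥) : T.range = ⊤ := by
  have : Module.Finite ℂ (F ⧸ T.range) := hT.finite_coker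
  rw [fredholmIndex, h_ker, finrank_bot] at h_index
  have h_coker : Module.finrank ℂ (F ⧸ T.range) = 0 := by lia
  exact Submodule.Quotient.subsingleton_iff.1 (Module.finrank_zero_iff.1 h_coker)

end Fredholm

section Coburn

theorem exists_fourierCoeff_ne_zero_least {n : ℕ} {f : L2 n} (hf : f ∈ H2 n) (h0 : f ≠ 0) :
    ∃ k : ℤ, 0 ≤ k ∧ fourierCoeff f k ≠ 0 ∧ ∀ j < k, fourierCoeff f j = 0 := by
  have h_nonneg (k : ℤ) (hk : fourierCoeff f k ≠ 0) : 0 ≤ k :=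
    not_lt.1 fun h => hk (mem_hardy.1 hf k h)
  obtain ⟨k, hk, h_min⟩ := Int.exists_least_of_bdd ⟨0, h_nonneg⟩
    (not_forall.1 (mt eq_zero_of_fourierCoeff_eq_zero h0))
  exact ⟨k, h_nonneg k hk, hk, fun j hj => not_not.1 fun h => hj.not_ge (h_min j h)⟩

theorem exists_fourierCoeff_ne_zero_greatest {n : ℕ} {f : L2 n} (hf : f ∈ H2minus n)
    (h0 : f ≠ 0) :
    ∃ k : ℤ, k < 0 ∧ fourierCoeff f k ≠ 0 ∧ ∀ j > k, fourierCoeff f j = 0 := by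
  have h_neg (k : ℤ) (hk : fourierCoeff f k ≠ 0) : k < 0 :=
    not_le.1 fun h => hk (mem_H2minus_iff.1 hf k h)
  obtain ⟨k, hk, h_max⟩ := Int.exists_greatest_of_bdd ⟨0, fun k hk => (h_neg k hk).le⟩
    (not_forall.1 (mt eq_zero_of_fourierCoeff_eq_zero h0))
  exact ⟨k, h_neg k hk, hk, fun j hj => not_not.1 fun h => hj.not_ge (h_max j h)⟩

variable {u : Linfty 1 1}

/-- If `a = uξ ∈ H²₋` has last nonzero coefficient at `q` and `h` has first nonzero coefficient at
`r`, then `z^{r-q}ξ ∈ H²` and `⟨h, u z^{r-q}ξ⟩` reduces to the one term `conj ĥ(r) â(q) ≠ 0`. -/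
theorem ker_toeplitz_eq_bot_or_orthogonal_range_eq_bot (hu : Function.Injective (mulOp u)) :
    (toeplitz u).ker = ⊥ ∨ (toeplitz u).rangeᗮ = ⊥ := by
  by_contra! h_ne
  obtain ⟨ξ, hξ, hξ0⟩ := (Submodule.ne_bot_iff _).1 h_ne.1
  obtain ⟨h, hh, hh0⟩ := (Submodule.ne_bot_iff _).1 h_ne.2
  have h_orth (f : H2 1) : inner ℂ (h : L2 1) (mulOp u f) = 0 := by
    have h1 : inner ℂ (h : L2 1) (toeplitz u f) = 0 :=
      (Submodule.mem_orthogonal' _ _).1 hh _ ⟨f, rfl⟩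
    rw [← toeplitz_add_hankel, inner_add_right, h1,
      (Submodule.mem_orthogonal _ _).1 (hankel u f).2 _ h.2, add_zero]
  have ha0 : mulOp u ξ ≠ 0 := fun ha =>
    hξ0 (Subtype.ext (hu (ha.trans (map_zero _).symm)))
  obtain ⟨q, hq_neg, hq, hq_max⟩ :=
    exists_fourierCoeff_ne_zero_greatest (toeplitz_eq_zero_iff.1 hξ) ha0
  obtain ⟨r, hr_nonneg, hr, hr_min⟩ :=
    exists_fourierCoeff_ne_zero_least h.2 fun h0 => hh0 (Subtype.ext h0)
  have h_term (j : ℤ) (hj : j ≠ r) : inner ℂ (fourierCoeff (h : L2 1) j)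
      (fourierCoeff (shift (r - q) (mulOp u ξ)) j) = 0 := by
    rcases hj.lt_or_gt with hj | hj
    · rw [hr_min j hj, inner_zero_left]
    · rw [fourierCoeff_shift, hq_max _ (by lia), inner_zero_right]
  have h_inner := (hasSum_single r h_term).unique (hasSum_inner_fourierCoeff _ _)
  have h_zero := h_orth ⟨shift (r - q) ξ, shift_mem_H2 (by lia) ξ.2⟩
  rw [← mulOp_shift, h_zero, mulOp_shift, fourierCoeff_shift, sub_sub_cancel, PiLp.inner_apply,
    Fin.sum_univ_one, RCLike.inner_apply', mul_eq_zero, map_eq_zero] at h_inner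
  have h_coord (x : EuclideanSpace ℂ (Fin 1)) (hx : x 0 = 0) : x = 0 :=
    PiLp.ext fun i => Subsingleton.elim i 0 ▸ hx
  exact h_inner.elim (hr ∘ h_coord _) (hq ∘ h_coord _)

theorem ker_toeplitz_eq_bot (hu : Function.Injective (mulOp u)) (hF : (toeplitz u).IsFredholm)
    (h_index : fredholmIndex (toeplitz u) ≤ 0) : (toeplitz u).ker = ⊥ :=
  (ker_toeplitz_eq_bot_or_orthogonal_range_eq_bot hu).elim id fun h_orth =>
    ker_eq_bot_of_fredholmIndex_nonpos hF h_index <| by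
      rw [← Submodule.topologicalClosure_eq_top_iff,
        hF.isClosed_range.submodule_topologicalClosure_eq] at h_orth
      exact h_orth

end Coburn

/-! ### Balanced matrix functions -/

/-- The matrix function `(v  Θ̄)` is balanced: it is unitary-valued, and its blocks `v` and `Θ` are
inner and co-outer. Thematic functions are the case of a single column `v`. As the blocks have
orthonormal columns, unitarity amounts to `v v* + Θ̄ Θᵗ = I`. -/
structure IsBalanced {n p k : ℕ} (v : Linfty n p) (Θ : Linfty n k) : Prop where
  inner_left : IsInner v
  coOuter_left : IsCoOuter v
  inner_right : IsInner Θ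
  coOuter_right : IsCoOuter Θ
  mul_add_mul_eq_one : ∀ᵐ t ∂(haarAddCircle : Measure Circ),
    v t * (v t)ᴴ + (Θ t).map star * (Θ t)ᵀ = 1

theorem conjTranspose_map_star {m n : ℕ} (A : Matrix (Fin m) (Fin n) ℂ) : (A.map star)ᴴ = Aᵀ :=
  Matrix.ext fun _ _ => star_star _

theorem IsThematic.isBalanced {n : ℕ} {v : Linfty n 1} {Θ : Linfty n (n - 1)}
    (h : IsThematic v Θ) : IsBalanced v Θ where
  inner_left := h.inner_v
  coOuter_left := h.coOuter_v
  inner_right := h.inner_Θ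
  coOuter_right := h.coOuter_Θ
  mul_add_mul_eq_one := by
    filter_upwards [h.unitary] with t ht
    have h_mul := ht.2
    rwa [thematicMatrix, Matrix.conjTranspose_fromCols_eq_fromRows_conjTranspose,
      Matrix.fromCols_mul_fromRows, conjTranspose_map_star] at h_mul

namespace IsBalanced

variable {n p k : ℕ} {v : Linfty n p} {Θ : Linfty n k}

theorem symm (h : IsBalanced v Θ) : IsBalanced Θ v where
  inner_left := h.inner_right
  coOuter_left := h.coOuter_right
  inner_right := h.inner_left
  coOuter_right := h.coOuter_left
  mul_add_mul_eq_one := by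
    filter_upwards [h.mul_add_mul_eq_one] with t ht
    have h_transp := congrArg Matrix.transpose ht
    rwa [Matrix.transpose_add, Matrix.transpose_mul, Matrix.transpose_mul, Matrix.transpose_one,
      Matrix.transpose_transpose, add_comm] at h_transp

theorem transp_mem_Hinfty (h : IsBalanced v Θ) : transp Θ ∈ Hinfty k n :=
  _root_.transp_mem_Hinfty h.inner_right.1

theorem mulOp_add_mulOp (h : IsBalanced v Θ) (f : L2 n) :
    mulOp v (mulOp (conjTransp v) f) + mulOp (conjEntries Θ) (mulOp (transp Θ) f) = f := by
  refine L2_ext ?_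
  filter_upwards [h.mul_add_mul_eq_one, conjTransp_ae v, transp_ae Θ, conjEntries_ae Θ,
    mulOp_mulOp_ae v (conjTransp v) f, mulOp_mulOp_ae (conjEntries Θ) (transp Θ) f,
    Lp.coeFn_add (mulOp v (mulOp (conjTransp v) f)) (mulOp (conjEntries Θ) (mulOp (transp Θ) f))]
    with t h_one h1 h2 h3 h_left h_right h_add
  rw [h_add, Pi.add_apply, WithLp.ofLp_add, h_left, h_right, h1, h2, h3, ← Matrix.add_mulVec,
    h_one, Matrix.one_mulVec]

theorem norm_sq_add_norm_sq (h : IsBalanced v Θ) (f : L2 n) :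
    ‖mulOp (conjTransp v) f‖ ^ 2 + ‖mulOp (transp Θ) f‖ ^ 2 = ‖f‖ ^ 2 := by
  have h_inner := congrArg (inner ℂ · f) (h.mulOp_add_mulOp f)
  simp only [inner_add_left, inner_mulOp_left, conjTransp_conjEntries, inner_self_eq_norm_sq_to_K]
    at h_inner
  exact_mod_cast h_inner

theorem transp_mulOp (h : IsBalanced v Θ) (a : L2 p) : mulOp (transp Θ) (mulOp v a) = 0 := by
  have h_norm := h.norm_sq_add_norm_sq (mulOp v a)
  rwa [h.inner_left.isIsometric.conjTransp_mulOp, h.inner_left.isIsometric.norm_mulOp,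
    add_eq_left, sq_eq_zero_iff, norm_eq_zero] at h_norm

theorem conjTransp_conjEntries_mulOp (h : IsBalanced v Θ) (a : L2 p) :
    mulOp (conjTransp Θ) (mulOp (conjEntries v) a) = 0 := by
  have h_iso := h.inner_left.isIsometric.conjEntries
  have h_norm := h.symm.norm_sq_add_norm_sq (mulOp (conjEntries v) a)
  rwa [← conjTransp_conjEntries v, h_iso.conjTransp_mulOp, h_iso.norm_mulOp, add_eq_right,
    sq_eq_zero_iff, norm_eq_zero] at h_norm

theorem conjTransp_conjEntries_add (h : IsBalanced v Θ) (a : L2 p) (b : L2 k) :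
    mulOp (conjTransp Θ) (mulOp (conjEntries v) a + mulOp Θ b) = b := by
  rw [map_add, h.conjTransp_conjEntries_mulOp, h.inner_right.isIsometric.conjTransp_mulOp, zero_add]

theorem transp_conjEntries_add (h : IsBalanced v Θ) (a : L2 p) (b : L2 k) :
    mulOp (transp v) (mulOp (conjEntries v) a + mulOp Θ b) = a := by
  rw [map_add, h.symm.transp_mulOp, ← conjTransp_conjEntries v,
    h.inner_left.isIsometric.conjEntries.conjTransp_mulOp, add_zero]

theorem norm_sq_conjEntries_add (h : IsBalanced v Θ) (a : L2 p) (b : L2 k) :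
    ‖mulOp (conjEntries v) a + mulOp Θ b‖ ^ 2 = ‖a‖ ^ 2 + ‖b‖ ^ 2 := by
  rw [← h.symm.norm_sq_add_norm_sq, h.conjTransp_conjEntries_add, h.transp_conjEntries_add,
    add_comm]

theorem exists_mem_H2_mulOp_eq (h : IsBalanced v Θ) {f : L2 n} (hf : f ∈ H2 n)
    (h0 : mulOp (transp Θ) f = 0) : ∃ a ∈ H2 p, mulOp v a = f := by
  have h_eq := h.mulOp_add_mulOp f
  rw [h0, map_zero, add_zero] at h_eq
  exact ⟨_, h.coOuter_left.mem_H2_of_mulOp (h_eq.symm ▸ hf), h_eq⟩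

end IsBalanced

/-! ### Block factorizations and maximizing vectors -/

/-- `G = (w̄  Ξ) diag(U, Ψ) (v  Θ̄)*` a.e., the factorization of `Factors` with an arbitrary number
of columns in `v` and `w`. -/
def BlockFactors {m n p q k l : ℕ} (G : Linfty m n) (w : Linfty m q) (Ξ : Linfty m l)
    (U : Linfty q p) (Ψ : Linfty l k) (v : Linfty n p) (Θ : Linfty n k) : Prop :=
  ∀ᵐ t ∂(haarAddCircle : Measure Circ),
    G t = (w t).map star * U t * (v t)ᴴ + Ξ t * Ψ t * (Θ t)ᵀ

theorem Factors.blockFactors {m n : ℕ} {G : Linfty m n} {w : Linfty m 1} {Ξ : Linfty m (m - 1)}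
    {u : Linfty 1 1} {Ψ : Linfty (m - 1) (n - 1)} {v : Linfty n 1} {Θ : Linfty n (n - 1)}
    (h : Factors G w Ξ u Ψ v Θ) : BlockFactors G w Ξ u Ψ v Θ := by
  filter_upwards [h] with t ht
  have hW : ((thematicMatrix w Ξ t)ᵀ)ᴴ = Matrix.fromCols ((w t).map star) (Ξ t) := by
    ext i (j | j) <;> simp [thematicMatrix]
  rw [ht, hW, thematicMatrix, Matrix.conjTranspose_fromCols_eq_fromRows_conjTranspose,
    Matrix.fromCols_mul_fromBlocks, Matrix.fromCols_mul_fromRows, conjTranspose_map_star]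
  simp only [Matrix.mul_zero, add_zero, zero_add]

namespace BlockFactors

variable {m n p q k l : ℕ} {G : Linfty m n} {w : Linfty m q} {Ξ : Linfty m l} {U : Linfty q p}
  {Ψ : Linfty l k} {v : Linfty n p} {Θ : Linfty n k}

theorem mulOp_eq (hG : BlockFactors G w Ξ U Ψ v Θ) (f : L2 n) :
    mulOp G f = mulOp (conjEntries w) (mulOp U (mulOp (conjTransp v) f)) +
      mulOp Ξ (mulOp Ψ (mulOp (transp Θ) f)) := by
  refine L2_ext ?_
  filter_upwards [hG, mulOp_ae G f, conjTransp_ae v, transp_ae Θ, conjEntries_ae w,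
    mulOp_ae (conjTransp v) f, mulOp_mulOp_ae (conjEntries w) U (mulOp (conjTransp v) f),
    mulOp_ae (transp Θ) f, mulOp_mulOp_ae Ξ Ψ (mulOp (transp Θ) f),
    Lp.coeFn_add (mulOp (conjEntries w) (mulOp U (mulOp (conjTransp v) f)))
      (mulOp Ξ (mulOp Ψ (mulOp (transp Θ) f)))]
    with t h_eq h1 h2 h3 h4 h5 h6 h7 h8 h_add
  rw [h_add, Pi.add_apply, WithLp.ofLp_add, h8, h7, h6, h5, h1, h_eq, h2, h3, h4]
  simp only [Matrix.mulVec_mulVec, Matrix.add_mulVec]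

theorem norm_sq_sub_norm_sq (hG : BlockFactors G w Ξ U Ψ v Θ) (hV : IsBalanced v Θ)
    (hW : IsBalanced w Ξ) (hU : IsIsometric U) (f : L2 n) :
    ‖f‖ ^ 2 - ‖mulOp G f‖ ^ 2 =
      ‖mulOp (transp Θ) f‖ ^ 2 - ‖mulOp Ψ (mulOp (transp Θ) f)‖ ^ 2 := by
  rw [hG.mulOp_eq, hW.norm_sq_conjEntries_add, hU.norm_mulOp, ← hV.norm_sq_add_norm_sq f]
  ring

theorem norm_mulOp_eq_iff (hG : BlockFactors G w Ξ U Ψ v Θ) (hV : IsBalanced v Θ)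
    (hW : IsBalanced w Ξ) (hU : IsIsometric U) (f : L2 n) :
    ‖mulOp G f‖ = ‖f‖ ↔ ‖mulOp Ψ (mulOp (transp Θ) f)‖ = ‖mulOp (transp Θ) f‖ := by
  have h := hG.norm_sq_sub_norm_sq hV hW hU f
  rw [← pow_left_inj₀ (norm_nonneg _) (norm_nonneg _) two_ne_zero, eq_comm, ← sub_eq_zero, h,
    sub_eq_zero, eq_comm, pow_left_inj₀ (norm_nonneg _) (norm_nonneg _) two_ne_zero]

theorem norm_mulOp_le (hG : BlockFactors G w Ξ U Ψ v Θ) (hV : IsBalanced v Θ)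
    (hW : IsBalanced w Ξ) (hU : IsIsometric U) (hΨ : ‖Ψ‖ ≤ 1) (f : L2 n) :
    ‖mulOp G f‖ ≤ ‖f‖ := by
  have h := hG.norm_sq_sub_norm_sq hV hW hU f
  have hle : ‖mulOp Ψ (mulOp (transp Θ) f)‖ ≤ ‖mulOp (transp Θ) f‖ :=
    (norm_mulOp_apply_le _ _).trans (mul_le_of_le_one_left (norm_nonneg _) hΨ)
  rw [← sq_le_sq₀ (norm_nonneg _) (norm_nonneg _)] at hle ⊢
  linarith

theorem mulH2_mem_maxVectors_iff (hG : BlockFactors G w Ξ U Ψ v Θ) (hV : IsBalanced v Θ)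
    (hW : IsBalanced w Ξ) (hU : IsIsometric U) (hnorm : ‖hankel G‖ = 1) (a : H2 p) :
    mulH2 hV.inner_left.1 a ∈ maxVectors G ↔ toeplitz U a = 0 := by
  have h_transp : mulOp (transp Θ) (mulOp v a) = 0 := hV.transp_mulOp a
  have h_norm : ‖mulOp G (mulH2 hV.inner_left.1 a)‖ = ‖mulH2 hV.inner_left.1 a‖ :=
    (hG.norm_mulOp_eq_iff hV hW hU _).2 <| by
      rw [coe_mulH2, h_transp, map_zero, norm_zero, norm_zero]
  have h_G : mulOp G (mulH2 hV.inner_left.1 a) = mulOp (conjEntries w) (mulOp U a) := by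
    rw [coe_mulH2, hG.mulOp_eq, h_transp, map_zero, map_zero, add_zero,
      hV.inner_left.isIsometric.conjTransp_mulOp]
  rw [mem_maxVectors_iff hnorm, toeplitz_eq_zero_iff, norm_hankel_eq_iff h_norm.le, h_G]
  refine ⟨fun h => hW.coOuter_left.mem_H2minus_of_conjEntries_mulOp h.1, fun h => ⟨?_, ?_⟩⟩
  · exact mulOp_mem_H2minus ((conjTransp_conjEntries w).symm ▸ hW.symm.transp_mem_Hinfty) h
  · rw [← h_norm, h_G]

theorem maxVectors_inf_ker (hG : BlockFactors G w Ξ U Ψ v Θ) (hV : IsBalanced v Θ)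
    (hW : IsBalanced w Ξ) (hU : IsIsometric U) (hnorm : ‖hankel G‖ = 1) :
    maxVectors G ⊓ (mulH2 hV.transp_mem_Hinfty).ker =
      (toeplitz U).ker.map (mulH2 hV.inner_left.1).toLinearMap := by
  refine le_antisymm ?_ ?_
  · rintro f ⟨hf, hf0⟩
    obtain ⟨a, ha, hva⟩ := hV.exists_mem_H2_mulOp_eq f.2 (congrArg Subtype.val hf0)
    have h_eq : mulH2 hV.inner_left.1 ⟨a, ha⟩ = f := Subtype.ext hva
    rw [← h_eq] at hf ⊢
    exact Submodule.mem_map_of_mem ((hG.mulH2_mem_maxVectors_iff hV hW hU hnorm _).1 hf)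
  · rintro _ ⟨a, ha, rfl⟩
    exact ⟨(hG.mulH2_mem_maxVectors_iff hV hW hU hnorm a).2 ha, Subtype.ext (hV.transp_mulOp a)⟩

theorem norm_hankel_mulH2 (hG : BlockFactors G w Ξ U Ψ v Θ) (hV : IsBalanced v Θ)
    (hW : IsBalanced w Ξ) (hU : IsIsometric U) (hnorm : ‖hankel G‖ = 1) (hΨ : ‖Ψ‖ ≤ 1) {f : H2 n}
    (hf : f ∈ maxVectors G) :
    ‖hankel Ψ (mulH2 hV.transp_mem_Hinfty f)‖ = ‖mulH2 hV.transp_mem_Hinfty f‖ := by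
  set g : H2 k := mulH2 hV.transp_mem_Hinfty f
  obtain ⟨h_mem, h_norm⟩ := (norm_hankel_eq_iff (hG.norm_mulOp_le hV hW hU hΨ f)).1
    ((mem_maxVectors_iff hnorm).1 hf)
  have hΨg_norm : ‖mulOp Ψ g‖ = ‖g‖ := (hG.norm_mulOp_eq_iff hV hW hU f).1 h_norm
  have hΨg_mem : mulOp Ψ g ∈ H2minus l := by
    have h_eq : mulOp (conjTransp Ξ) (mulOp G f) = mulOp Ψ g := by
      rw [hG.mulOp_eq, hW.conjTransp_conjEntries_add]
      rfl
    refine h_eq ▸ mulOp_mem_H2minus ?_ h_mem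
    exact (conjTransp_conjTransp Ξ).symm ▸ hW.inner_right.1
  exact (norm_hankel_eq_iff hΨg_norm.le).2 ⟨hΨg_mem, hΨg_norm⟩

theorem map_maxVectors_le (hG : BlockFactors G w Ξ U Ψ v Θ) (hV : IsBalanced v Θ)
    (hW : IsBalanced w Ξ) (hU : IsIsometric U) (hnorm : ‖hankel G‖ = 1) (hΨ : ‖Ψ‖ ≤ 1) :
    (maxVectors G).map (mulH2 hV.transp_mem_Hinfty).toLinearMap ≤ maxVectors Ψ := by
  rintro _ ⟨f, hf, rfl⟩
  exact mem_maxVectors_of_norm_le_one hΨ (hG.norm_hankel_mulH2 hV hW hU hnorm hΨ hf)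

end BlockFactors

/-! ### Lifting maximizing vectors through `Θᵗ` -/

namespace BlockFactors

open Filter Topology

variable {m n p q k l : ℕ} {G : Linfty m n} {w : Linfty m q} {Ξ : Linfty m l} {U : Linfty q p}
  {Ψ : Linfty l k} {v : Linfty n p} {Θ : Linfty n k}

/-- `F = f - vξ`, where `ξ` solves `T_U ξ = ℙ₊(U v* f - wᵗ y)`. -/
theorem exists_norm_toeplitz_le (hG : BlockFactors G w Ξ U Ψ v Θ) (hV : IsBalanced v Θ)
    (hW : IsBalanced w Ξ) (h_range : (toeplitz U).range = ⊤) {f : L2 n} (hf : f ∈ H2 n)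
    {y : L2 m} (hy : y ∈ H2minus m) :
    ∃ F : H2 n, mulOp (transp Θ) F = mulOp (transp Θ) f ∧
      ‖toeplitz G F‖ ≤ ‖mulOp Ψ (mulOp (transp Θ) f) - mulOp (conjTransp Ξ) y‖ := by
  obtain ⟨ξ, hξ⟩ := exists_mulOp_sub_mem_H2minus h_range
    (mulOp U (mulOp (conjTransp v) f) - mulOp (transp w) y)
  set d : L2 q := mulOp U ξ - (mulOp U (mulOp (conjTransp v) f) - mulOp (transp w) y)
  set r : L2 m := mulOp Ξ (mulOp Ψ (mulOp (transp Θ) f) - mulOp (conjTransp Ξ) y)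
  have h_transp : mulOp (transp Θ) (f - mulOp v ξ) = mulOp (transp Θ) f := by
    rw [map_sub, hV.transp_mulOp, sub_zero]
  have h_sub : mulOp G (f - mulOp v ξ) - r = y - mulOp (conjEntries w) d := by
    rw [hG.mulOp_eq, h_transp, map_sub (mulOp (conjTransp v)),
      hV.inner_left.isIsometric.conjTransp_mulOp]
    conv_rhs => rw [← hW.symm.mulOp_add_mulOp y]
    simp only [d, r, map_sub]
    abel
  have h_mem : y - mulOp (conjEntries w) d ∈ H2minus m :=
    Submodule.sub_mem _ hy <| mulOp_mem_H2minus
      ((conjTransp_conjEntries w).symm ▸ hW.symm.transp_mem_Hinfty) hξ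
  refine ⟨⟨f - mulOp v ξ, Submodule.sub_mem _ hf (mulOp_mem_H2 hV.inner_left.1 ξ.2)⟩, h_transp, ?_⟩
  exact (norm_toeplitz_le_of_sub_mem_H2minus (h_sub ▸ h_mem)).trans_eq
    (hW.inner_right.isIsometric.norm_mulOp _)

theorem exists_seq_norm_toeplitz_tendsto_zero (hG : BlockFactors G w Ξ U Ψ v Θ)
    (hV : IsBalanced v Θ) (hW : IsBalanced w Ξ) (h_range : (toeplitz U).range = ⊤) {g : L2 k}
    (hg : g ∈ H2 k) (hΨg : mulOp Ψ g ∈ H2minus l) :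
    ∃ F : ℕ → H2 n, Tendsto (fun j => mulOp (transp Θ) (F j)) atTop (𝓝 g) ∧
      Tendsto (fun j => ‖toeplitz G (F j)‖) atTop (𝓝 0) := by
  obtain ⟨x, hx, hx_lim⟩ := mem_closure_iff_seq_limit.1 (hV.coOuter_right.subset_closure hg)
  obtain ⟨y, hy, hy_lim⟩ :=
    mem_closure_iff_seq_limit.1 (hW.coOuter_right.subset_closure_conjEntries hΨg)
  have h_exists (j : ℕ) : ∃ F : H2 n, mulOp (transp Θ) F = x j ∧
      ‖toeplitz G F‖ ≤ ‖mulOp Ψ (x j) - y j‖ := by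
    obtain ⟨f, hf, hfx⟩ := hx j
    obtain ⟨b, hb, hby⟩ := hy j
    rw [← hfx, ← hby, conjEntries_transp]
    exact hG.exists_norm_toeplitz_le hV hW h_range hf hb
  choose F hFx hF_le using h_exists
  have h_lim := ((((mulOp Ψ).continuous.tendsto g).comp hx_lim).sub hy_lim).norm
  rw [sub_self, norm_zero] at h_lim
  exact ⟨F, hx_lim.congr fun j => (hFx j).symm, squeeze_zero (fun _ => norm_nonneg _) hF_le h_lim⟩

theorem defect_hankel_eq (hG : BlockFactors G w Ξ U Ψ v Θ) (hV : IsBalanced v Θ)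
    (hW : IsBalanced w Ξ) (hU : IsIsometric U) (hnorm : ‖hankel G‖ = 1) (f : H2 n) :
    defect (hankel G) f = ‖mulOp (transp Θ) f‖ ^ 2 - ‖mulOp Ψ (mulOp (transp Θ) f)‖ ^ 2 +
      ‖toeplitz G f‖ ^ 2 := by
  rw [← hG.norm_sq_sub_norm_sq hV hW hU, ← norm_sq_toeplitz_add_norm_sq_hankel G f, defect, hnorm,
    one_pow, one_mul, Submodule.coe_norm f]
  ring

theorem maxVectors_le_map (hG : BlockFactors G w Ξ U Ψ v Θ) (hV : IsBalanced v Θ)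
    (hW : IsBalanced w Ξ) (hU : IsIsometric U) (hess : essNorm (hankel G) < 1)
    (hnorm : ‖hankel G‖ = 1) (hΨ : ‖Ψ‖ ≤ 1) (hΨ_norm : ‖hankel Ψ‖ = 1)
    (h_range : (toeplitz U).range = ⊤) :
    maxVectors Ψ ≤ (maxVectors G).map (mulH2 hV.transp_mem_Hinfty).toLinearMap := by
  intro g hg
  obtain ⟨hΨg, hg_norm⟩ := (norm_hankel_eq_iff
    ((norm_mulOp_apply_le Ψ g).trans (mul_le_of_le_one_left (norm_nonneg _) hΨ))).1
    ((mem_maxVectors_iff hΨ_norm).1 hg)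
  obtain ⟨F, hF, hF_toeplitz⟩ := hG.exists_seq_norm_toeplitz_tendsto_zero hV hW h_range g.2 hΨg
  refine mem_map_maximizing_of_tendsto (hess.trans_eq hnorm.symm) (mulH2 hV.transp_mem_Hinfty)
    (tendsto_subtype_rng.2 hF) ?_
  have h_lim := ((hF.norm.pow 2).sub
    ((((mulOp Ψ).continuous.tendsto _).comp hF).norm.pow 2)).add (hF_toeplitz.pow 2)
  rw [hg_norm, Submodule.coe_norm, sub_self, zero_pow two_ne_zero, add_zero] at h_lim
  exact h_lim.congr fun j => (hG.defect_hankel_eq hV hW hU hnorm (F j)).symm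

theorem norm_hankel_eq_one (hG : BlockFactors G w Ξ U Ψ v Θ) (hV : IsBalanced v Θ)
    (hW : IsBalanced w Ξ) (hU : IsIsometric U) (hess : essNorm (hankel G) < 1)
    (hnorm : ‖hankel G‖ = 1) (hΨ : ‖Ψ‖ ≤ 1) (h_ker : (toeplitz U).ker = ⊥) :
    ‖hankel Ψ‖ = 1 := by
  obtain ⟨f, hf, hf0⟩ :=
    (Submodule.ne_bot_iff _).1 (maximizing_ne_bot (hess.trans_eq hnorm.symm))
  set g : H2 k := mulH2 hV.transp_mem_Hinfty f
  have hg0 : g ≠ 0 := fun h0 => hf0 <| by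
    have h_mem : f ∈ maxVectors G ⊓ (mulH2 hV.transp_mem_Hinfty).ker := ⟨hf, h0⟩
    rwa [hG.maxVectors_inf_ker hV hW hU hnorm, h_ker, Submodule.map_bot] at h_mem
  have hg : ‖hankel Ψ g‖ = ‖g‖ := hG.norm_hankel_mulH2 hV hW hU hnorm hΨ hf
  refine ((norm_hankel_le Ψ).trans hΨ).antisymm ?_
  exact (le_mul_iff_one_le_left (norm_pos_iff.2 hg0)).1 (hg ▸ (hankel Ψ).le_opNorm g)

end BlockFactors

/-! ### Dimensions of the spaces of maximizing vectors -/

theorem rank_map_add_rank_inf_ker.{u, v} {K : Type u} {V W : Type v} [DivisionRing K]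
    [AddCommGroup V] [Module K V] [AddCommGroup W] [Module K W] (T : V →ₗ[K] W)
    (M : Submodule K V) :
    Module.rank K (M.map T) + Module.rank K ↥(M ⊓ LinearMap.ker T) = Module.rank K M := by
  have h_ker : Module.rank K (LinearMap.ker (T.domRestrict M)) =
      Module.rank K ↥(M ⊓ LinearMap.ker T) := by
    rw [LinearMap.ker_domRestrict, ← Submodule.map_comap_subtype]
    exact (Submodule.equivMapOfInjective M.subtype M.injective_subtype _).rank_eq
  rw [← h_ker, ← LinearMap.range_domRestrict, LinearMap.rank_range_add_rank_ker]

theorem BlockFactors.rank_maxVectors_eq_add {m n p q k l : ℕ} {G : Linfty m n} {w : Linfty m q}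
    {Ξ : Linfty m l} {U : Linfty q p} {Ψ : Linfty l k} {v : Linfty n p} {Θ : Linfty n k}
    (hG : BlockFactors G w Ξ U Ψ v Θ) (hV : IsBalanced v Θ)
    (hW : IsBalanced w Ξ) (hU : IsIsometric U) (hnorm : ‖hankel G‖ = 1) :
    Module.rank ℂ (maxVectors G) =
      Module.rank ℂ ((maxVectors G).map (mulH2 hV.transp_mem_Hinfty).toLinearMap) +
        Module.rank ℂ (toeplitz U).ker := by
  have h_inj : Function.Injective (mulH2 hV.inner_left.1) := fun _ _ h =>
    Subtype.ext (hV.inner_left.isIsometric.injective_mulOp (congrArg Subtype.val h))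
  rw [← rank_map_add_rank_inf_ker (mulH2 hV.transp_mem_Hinfty).toLinearMap (maxVectors G),
    hG.maxVectors_inf_ker hV hW hU hnorm]
  exact congrArg _ (Submodule.equivMapOfInjective _ h_inj _).symm.rank_eq

theorem mainTheorem8_general {m n p q k l : ℕ} (G : Linfty m n) (hnorm : ‖hankel G‖ = 1)
    (w : Linfty m q) (Ξ : Linfty m l) (U : Linfty q p) (Ψ : Linfty l k) (v : Linfty n p)
    (Θ : Linfty n k) (hV : IsBalanced v Θ) (hW : IsBalanced w Ξ) (hU : IsIsometric U)
    (hG : BlockFactors G w Ξ U Ψ v Θ) :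
    (∀ f ∈ maxVectors G,
      (∀ᵐ t ∂(haarAddCircle : Measure Circ), (Θ t)ᵀ *ᵥ ((f : L2 n) t).ofLp = 0) →
      ∃ ξ ∈ (toeplitz U).ker, ∀ᵐ t ∂(haarAddCircle : Measure Circ),
        ∀ i, (f : L2 n) t i = ∑ j, (ξ : L2 p) t j * v t i j) ∧
    (‖Ψ‖ ≤ 1 →
      Module.rank ℂ (maxVectors G) ≤
        Module.rank ℂ (maxVectors Ψ) + Module.rank ℂ (toeplitz U).ker ∧
      (essNorm (hankel G) < 1 → ‖hankel Ψ‖ = 1 → (toeplitz U).range = ⊤ →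
        Module.rank ℂ (maxVectors G) =
          Module.rank ℂ (maxVectors Ψ) + Module.rank ℂ (toeplitz U).ker)) := by
  refine ⟨fun f hf hΘ => ?_, fun hΨ => ?_⟩
  · have hΘf : f ∈ maxVectors G ⊓ (mulH2 hV.transp_mem_Hinfty).ker :=
      ⟨hf, Subtype.ext (mulOp_transp_eq_zero_iff.2 hΘ)⟩
    rw [hG.maxVectors_inf_ker hV hW hU hnorm] at hΘf
    obtain ⟨ξ, hξ, rfl⟩ := hΘf
    exact ⟨ξ, hξ, mulOp_apply_ae v ξ⟩
  · have h_le := hG.map_maxVectors_le hV hW hU hnorm hΨ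
    rw [hG.rank_maxVectors_eq_add hV hW hU hnorm]
    refine ⟨add_le_add_left (Submodule.rank_mono h_le) _, fun hess hΨ_norm h_range => ?_⟩
    rw [h_le.antisymm (hG.maxVectors_le_map hV hW hU hess hnorm hΨ hΨ_norm h_range)]

theorem mainTheorem8 {m n : ℕ} (hm : 2 ≤ m) (hn : 2 ≤ n)
    (G : Linfty m n) (hess : essNorm (hankel G) < 1) (hnorm : ‖hankel G‖ = 1)
    (hbad : IsBadlyApprox G)
    (w : Linfty m 1) (Ξ : Linfty m (m - 1)) (u : Linfty 1 1) (Ψ : Linfty (m - 1) (n - 1))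
    (v : Linfty n 1) (Θ : Linfty n (n - 1))
    (hV : IsThematic v Θ) (hW : IsThematic w Ξ) (hu : IsUnimodular u)
    (hG : Factors G w Ξ u Ψ v Θ) :
    (∀ f ∈ maxVectors G,
      (∀ᵐ t ∂(haarAddCircle : Measure Circ), (Θ t)ᵀ *ᵥ ((f : L2 n) t).ofLp = 0) →
      ∃ ξ ∈ (toeplitz u).ker, ∀ᵐ t ∂(haarAddCircle : Measure Circ),
        ∀ i, (f : L2 n) t i = (ξ : L2 1) t 0 * v t i 0) ∧
    (IsBadlyApprox Ψ → ‖Ψ‖ = 1 → (toeplitz u).IsFredholm → fredholmIndex (toeplitz u) ≤ 0 →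
      Module.rank ℂ (maxVectors G) ≤ Module.rank ℂ (maxVectors Ψ) ∧
      (fredholmIndex (toeplitz u) = 0 →
        Module.rank ℂ (maxVectors G) = Module.rank ℂ (maxVectors Ψ))) := by
  obtain ⟨h_ker, h_rank⟩ := mainTheorem8_general G hnorm w Ξ u Ψ v Θ hV.isBalanced hW.isBalanced
    hu.isIsometric hG.blockFactors
  refine ⟨by simpa only [Fin.sum_univ_one] using h_ker, fun _ hΨ hF h_index => ?_⟩
  have h_bot := ker_toeplitz_eq_bot hu.isIsometric.injective_mulOp hF h_index
  rw [h_bot, rank_bot, add_zero] at h_rank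
  exact (h_rank hΨ.le).imp_right fun h_eq h_zero => h_eq hess
    (hG.blockFactors.norm_hankel_eq_one hV.isBalanced hW.isBalanced hu.isIsometric hess hnorm hΨ.le
      h_bot)
    (range_eq_top_of_fredholmIndex_eq_zero hF h_zero h_bot)
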